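/- Let $m,n\ge 1$ be coprime integers. For $l\ge 0$, a generalized Schröder path of size $l$ is a lattice path from $(0,0)$ to $(nl,ml)$ with steps $(1,0)$, $(0,1)$, $(1,1)$ that never goes above the line $y=\frac{mx}{n}$. Its midway points are the lattice points on it whose $x$-coordinate is not $nl$ and whose $y$-coordinate is not $0$. For integers $i,j,l,s\ge 0$ let $n^{[s]}_{i,j,l}$ be the number of generalized Schröder paths of size $l$ with exactly $\frac i2$ diagonal steps, with area $\frac j2$ between the path and the line $y=\frac{mx}{n}$, and all of whose midway points $(x,y)$ satisfy $y\le\frac{mx-s}{n}$; by convention $n^{[s]}_{i,j,l}=0$ if $s>mnl$. Let $R$ be a commutative ring, $a\in R$ and $q\in R^{\times}$ (for example $R=\mathbb Z[a,q^{\pm1}]$ with $a,q$ indeterminates), and put $$y^{[s]}(x)=y^{[s]}(a,q;x)=\sum_{i,j,l\ge 0} n^{[s]}_{i,j,l}\,a^iq^jx^l\in R[[x]]\qquad(0\le s\le mn),$$ where for each $l$ the sum over $i,j$ is finite. For $0<s<mn$ let $\alpha_s,\beta_s$ be the integers with $$0\le\alpha_s<n,\quad \alpha_s m\equiv s \pmod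 n,\qquad 0\le\beta_s<m,\quad \beta_s n\equiv s\pmod m,$$ and let $\epsilon_s=\frac{\alpha_sm+\beta_sn-s}{mn}\in\mathbb Z$. **Theorem.** The series $y^{[0]},\dots,y^{[mn]}$ satisfy the $q$-difference equations $$y^{[0]}(x)=\frac{1}{1-y^{[1]}(x)},$$ $$y^{[s]}(x)=y^{[s+1]}(x)+q^{mn\epsilon_s^2-2\alpha_s\beta_s}x^{-\epsilon_s}\,y^{[0]}(q^{2s}x)\,y^{[\beta_sn+1]}(q^{2(s-\beta_sn)}x)\,y^{[\alpha_sm+1]}(q^{2(s-\alpha_sm)}x)\qquad(0<s<mn),$$ $$y^{[mn]}(x)=a^2q^{mn-1}x+q^{mn}x\,y^{[0]}(q^{2mn}x),$$ with the initial values $y^{[0]}(0)=1$, $y^{[s]}(0)=0$ for $0<s<mn$, and $y^{[mn]}(0)=0$. Moreover, they are the only family of $mn+1$ power series in $R[[x]]$ that satisfies these equations and initial values. -/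

import Mathlib

namespace SchroderPath

/-- The three steps `(1,0)`, `(0,1)`, `(1,1)` of a generalized Schröder path. -/
inductive Step
  | right
  | up
  | diag
  deriving DecidableEq

instance : Finite Step :=
  Finite.of_surjective (fun k : Fin 3 => if k = 0 then Step.right else if k = 1 then Step.up else Step.diag)
    (by
      intro t
      cases t
      · exact ⟨0, rfl⟩
      · exact ⟨1, rfl⟩
      · exact ⟨2, rfl⟩)

/-- The displacement vector of a step. -/
def Step.vec : Step → ℕ × ℕ
  | .right => (1, 0)
  | .up => (0, 1)
  | .diag => (1, 1)

/-- The end point of the path that starts at `(0,0)` and has the given list of steps. -/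
def endPoint (p : List Step) : ℕ × ℕ := (p.map Step.vec).sum

/-- The `k`-th lattice point of the path, i.e. the point reached after `k` steps. -/
def point (p : List Step) (k : ℕ) : ℕ × ℕ := endPoint (p.take k)

/-- Twice the area enclosed between the path and the chord from its end point back to its
starting point `(0,0)`, by the shoelace formula. (The chord passes through the origin and hence
contributes `0` to the sum; the sign is positive for a path that runs below its chord.) -/
def twiceArea (p : List Step) : ℤ :=
  ∑ k ∈ Finset.range p.length,
    (((point p k).1 : ℤ) * (point p (k + 1)).2 - ((point p (k + 1)).1 : ℤ) * (point p k).2)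

/-- Generalized Schröder paths of slope `m / n` and size `l`: lattice paths from `(0,0)` to
`(n l, m l)` that never go above the line `y = m x / n`. (The line is straight, so it is enough to
look at the lattice points of the path.) -/
def IsPath (m n l : ℕ) (p : List Step) : Prop :=
  endPoint p = (n * l, m * l) ∧
    ∀ k ≤ p.length, n * (point p k).2 ≤ m * (point p k).1

/-- The midway points of the path, i.e. its lattice points with `x`-coordinate different from
`n l` and `y`-coordinate different from `0`, do not exceed the line `y = (m x - s) / n`. -/
def MidwayBelow (m n s l : ℕ) (p : List Step) : Prop :=
  ∀ k ≤ p.length, (point p k).1 ≠ n * l → (point p k).2 ≠ 0 →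
    (n : ℤ) * (point p k).2 ≤ (m : ℤ) * (point p k).1 - s

/-- The paths counted by `n_{i,j,l}^{[s]}`: size `l`, `i / 2` diagonal steps, area `j / 2`, midway
points not exceeding `y = (m x - s) / n`; by convention there are none when `s > m n l`. -/
def countedPaths (m n s i j l : ℕ) : Set (List Step) :=
  {p | s ≤ m * n * l ∧ IsPath m n l p ∧ MidwayBelow m n s l p ∧
    2 * p.count Step.diag = i ∧ twiceArea p = (j : ℤ)}

/-- The number `n_{i,j,l}^{[s]}`. -/
noncomputable def pathCount (m n s i j l : ℕ) : ℕ := (countedPaths m n s i j l).ncard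

theorem length_le_endPoint (p : List Step) :
    p.length ≤ (endPoint p).1 + (endPoint p).2 := by
  induction p with
  | nil => simp
  | cons t p ih =>
    have h : endPoint (t :: p) = t.vec + endPoint p := by simp [endPoint]
    rw [h]
    cases t <;> simp [Step.vec] <;> omega

theorem finite_isPath (m n l : ℕ) : {p | IsPath m n l p}.Finite := by
  refine (List.finite_length_le Step (n * l + m * l)).subset ?_
  intro p hp
  have h := length_le_endPoint p
  rw [hp.1] at h
  exact h

theorem finite_countedPaths (m n s i j l : ℕ) : (countedPaths m n s i j l).Finite :=
  (finite_isPath m n l).subset fun _ hp => hp.2.1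

/-- For fixed `s` and `l` only finitely many of the numbers `n_{i,j,l}^{[s]}` are nonzero, so that
the sum over `i, j` in `genFun` is a finite one. -/
theorem finite_support_pathCount (m n s l : ℕ) :
    (Function.support fun ij : ℕ × ℕ => pathCount m n s ij.1 ij.2 l).Finite := by
  refine ((finite_isPath m n l).image
    fun p => (2 * p.count Step.diag, (twiceArea p).toNat)).subset ?_
  intro ij h
  have h1 : (countedPaths m n s ij.1 ij.2 l).Nonempty :=
    (Set.ncard_pos (finite_countedPaths m n s ij.1 ij.2 l)).1 (Nat.pos_of_ne_zero h)
  obtain ⟨p, hp⟩ := h1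
  refine ⟨p, hp.2.1, ?_⟩
  obtain ⟨-, -, -, h2, h3⟩ := hp
  ext
  · exact h2
  · simp [h3]

/-- The generating function `y^{[s]}(a,q;x) = ∑_{i,j,l} n_{i,j,l}^{[s]} a^i q^j x^l`, a power series
in `x`; the coefficient of each `x^l` is a finite sum. -/
noncomputable def genFun (m n : ℕ) {R : Type*} [CommRing R] (a : R) (q : Rˣ) (s : ℕ) :
    PowerSeries R :=
  PowerSeries.mk fun l =>
    ∑ᶠ ij : ℕ × ℕ, (pathCount m n s ij.1 ij.2 l : R) * a ^ ij.1 * (q : R) ^ ij.2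

/-- `qShift q k f` is `f(q^k x)`. -/
noncomputable def qShift {R : Type*} [CommRing R] (q : Rˣ) (k : ℤ) (f : PowerSeries R) :
    PowerSeries R :=
  PowerSeries.rescale ((q ^ k : Rˣ) : R) f

/-- The numbers `α_s`, `β_s`, `ε_s`: `0 ≤ α < n` with `α m ≡ s` modulo `n`, `0 ≤ β < m` with
`β n ≡ s` modulo `m`, and `ε = (α m + β n - s) / (m n)`. -/
structure Indices (m n s α β : ℕ) (ε : ℤ) : Prop where
  alpha_lt : α < n
  alpha_modEq : α * m ≡ s [MOD n]
  beta_lt : β < m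
  beta_modEq : β * n ≡ s [MOD m]
  eps_eq : (ε : ℚ) = ((α : ℚ) * m + (β : ℚ) * n - s) / ((m : ℚ) * n)

/-- For coprime positive `m`, `n` the numbers `α_s`, `β_s`, `ε_s` exist, `ε_s` being an integer. -/
theorem exists_indices {m n : ℕ} (hm : 0 < m) (hn : 0 < n) (h : Nat.Coprime m n) (s : ℕ) :
    ∃ (α β : ℕ) (ε : ℤ), Indices m n s α β ε := by
  have key : ∀ {u v : ℕ}, 0 < v → Nat.Coprime u v → ∃ c < v, c * u ≡ s [MOD v] := by
    intro u v hv huv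
    obtain ⟨w, hw, hw'⟩ := Nat.exists_mul_mod_eq_of_coprime s huv hv.ne'
    exact ⟨w, hw, by rw [mul_comm]; exact hw'⟩
  obtain ⟨α, h1, h2⟩ := key hn h
  obtain ⟨β, h3, h4⟩ := key hm h.symm
  have d1 : (n : ℤ) ∣ (α : ℤ) * m + (β : ℤ) * n - s := by
    have h5 : (n : ℤ) ∣ (α : ℤ) * m - s := by
      have := (Nat.modEq_iff_dvd.1 h2.symm)
      push_cast at this
      exact this
    have h6 : (α : ℤ) * m + (β : ℤ) * n - s = ((α : ℤ) * m - s) + (β : ℤ) * n := by ring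
    rw [h6]
    exact dvd_add h5 (dvd_mul_left _ _)
  have d2 : (m : ℤ) ∣ (α : ℤ) * m + (β : ℤ) * n - s := by
    have h5 : (m : ℤ) ∣ (β : ℤ) * n - s := by
      have := (Nat.modEq_iff_dvd.1 h4.symm)
      push_cast at this
      exact this
    have h6 : (α : ℤ) * m + (β : ℤ) * n - s = (α : ℤ) * m + ((β : ℤ) * n - s) := by ring
    rw [h6]
    exact dvd_add (dvd_mul_left _ _) h5
  obtain ⟨ε, hε⟩ := (Nat.isCoprime_iff_coprime.2 h).mul_dvd d2 d1
  refine ⟨α, β, ε, h1, h2, h3, h4, ?_⟩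
  have hm' : (m : ℚ) ≠ 0 := by exact_mod_cast hm.ne'
  have hn' : (n : ℚ) ≠ 0 := by exact_mod_cast hn.ne'
  rw [eq_div_iff (mul_ne_zero hm' hn')]
  have h7 : (α : ℚ) * m + (β : ℚ) * n - s = (m : ℚ) * n * ε := by exact_mod_cast hε
  rw [h7]
  ring

/-- The system of `q`-difference equations, with initial values, for a family of power series
`Y 0, …, Y (m n)` in `x` (later members of the sequence `Y` do not occur). -/
structure IsSolution (m n : ℕ) {R : Type*} [CommRing R] (a : R) (q : Rˣ)
    (Y : ℕ → PowerSeries R) : Prop where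
  /-- `Y_0 = 1 / (1 - Y_1)`. -/
  eq_zero : Y 0 * (1 - Y 1) = 1
  /-- The equation for `0 < s < m n`. Because of the factor `x^{-ε}` it is an equation of
  Laurent series in `x`. -/
  eq_mid : ∀ s : ℕ, 0 < s → s < m * n → ∀ (α β : ℕ) (ε : ℤ), Indices m n s α β ε →
    (Y s : LaurentSeries R) = (Y (s + 1) : LaurentSeries R) +
      HahnSeries.single (-ε)
          ((q ^ ((m : ℤ) * n * ε ^ 2 - 2 * (α : ℤ) * β) : Rˣ) : R) *
        ((qShift q (2 * (s : ℤ)) (Y 0) *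
          qShift q (2 * ((s : ℤ) - (β : ℤ) * n)) (Y (β * n + 1)) *
          qShift q (2 * ((s : ℤ) - (α : ℤ) * m)) (Y (α * m + 1)) : PowerSeries R) :
            LaurentSeries R)
  /-- `Y_{mn} = a² q^{mn-1} x + q^{mn} x Y_0(q^{2mn} x)`. -/
  eq_last : Y (m * n) =
    PowerSeries.C (a ^ 2 * ((q ^ ((m : ℤ) * n - 1) : Rˣ) : R)) * PowerSeries.X +
      PowerSeries.C ((q : R) ^ (m * n)) * PowerSeries.X *
        qShift q (2 * ((m : ℤ) * n)) (Y 0)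
  init_zero : PowerSeries.constantCoeff (Y 0) = 1
  init_mid : ∀ s : ℕ, 0 < s → s < m * n → PowerSeries.constantCoeff (Y s) = 0
  init_last : PowerSeries.constantCoeff (Y (m * n)) = 0

end SchroderPath

/-!
The coefficient of `x^l` in `y^{[s]}` is the sum of the weights `a^(2 · diagonal steps)` times
`q^(2 · area)` over
a finite set of paths (`coeff_genFun`), so the equations are identities between weighted sums over
paths. With the area given by the shoelace formula, concatenating two paths multiplies the weights,
up to the power of `q` given by the cross product of the two chords (`twiceArea_append`). A unique
factorization of the members of a set of paths therefore gives a formula for its weighted sum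
(`weightSum_eq_sum_mul`). Signed areas make this work for arbitrary pieces, also for those that do
not lie below their chord.

Call `m x - n y` the height of a point. The paths counted by `y^{[s]}` but not by `y^{[s+1]}`, where
`0 < s < m n`, are those with a midway point of height exactly `s`. Such a path is cut at the first
and at the last of these points (`weightSum_paths_eq_add`, `weightSum_tails`). As `m` and `n` are
coprime, the cutting points are `(n (i - ε) + α, m i - β)` with `i ≥ 1`. The middle piece is an
arbitrary path below its chord and gives `y^{[0]}`. If `β` vertical steps are appended to the initial
piece and its starting point is moved along the `x`-axis, it becomes a path counted by `y^{[β n + 1]}`: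
its height conditions force enough horizontal steps at the start for this to be reversible
(`weightSum_arrivals_eq_paths`). Reflection in an anti-diagonal, which exchanges `m` with `n` and `α`
with `β`, reduces the final piece to the initial one (`weightSum_departures_eq_paths`). Collecting the
powers of `q` gives the exponents in the equation (`weightSum_paths_eq_add_sum`). The equation for
`y^{[0]}` is the decomposition at the last touching point of the line `y = m x / n`
(`weightSum_paths_zero`), and a path counted by `y^{[m n]}` starts with `n` horizontal and ends with
`m` vertical steps, with the single exception `hookPath` (`weightSum_paths_mul`).

For uniqueness, two solutions are shown to agree to order `x^l` by induction on `l`, and within a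
step for `s = m n, …, 1, 0` in this order (`IsSolution.X_pow_dvd_sub`). The factor `x^{-ε}` does no
harm: if `ε = 1`, then `α m + β n = s + m n` gives `α m, β n > s`, so the other two series of positive
index in the equation have already been treated, and both lack a constant term.
-/

namespace SchroderPath

/-! ### Coordinates, height and area of a list of steps -/

/-- The `x`-coordinate of the end point, as an integer. -/
def xEnd (p : List Step) : ℤ := (endPoint p).1

/-- The `y`-coordinate of the end point, as an integer. -/
def yEnd (p : List Step) : ℤ := (endPoint p).2

/-- The value of the linear form `m x - n y` at the end point; it vanishes on the line
`y = m x / n` and equals `s` on the line `y = (m x - s) / n`. -/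
def height (m n : ℕ) (p : List Step) : ℤ := m * xEnd p - n * yEnd p

@[simp] theorem xEnd_nil : xEnd [] = 0 := by simp [xEnd, endPoint]
@[simp] theorem yEnd_nil : yEnd [] = 0 := by simp [yEnd, endPoint]
@[simp] theorem xEnd_append (u v : List Step) : xEnd (u ++ v) = xEnd u + xEnd v := by
  simp [xEnd, endPoint]
@[simp] theorem yEnd_append (u v : List Step) : yEnd (u ++ v) = yEnd u + yEnd v := by
  simp [yEnd, endPoint]
@[simp] theorem xEnd_cons (t : Step) (v : List Step) :
    xEnd (t :: v) = (t.vec.1 : ℤ) + xEnd v := by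
  simp [xEnd, endPoint]
@[simp] theorem yEnd_cons (t : Step) (v : List Step) :
    yEnd (t :: v) = (t.vec.2 : ℤ) + yEnd v := by
  simp [yEnd, endPoint]
@[simp] theorem vec_right : Step.right.vec = (1, 0) := rfl
@[simp] theorem vec_up : Step.up.vec = (0, 1) := rfl
@[simp] theorem vec_diag : Step.diag.vec = (1, 1) := rfl

theorem xEnd_nonneg (p : List Step) : 0 ≤ xEnd p := by simp [xEnd]
theorem yEnd_nonneg (p : List Step) : 0 ≤ yEnd p := by simp [yEnd]

@[simp] theorem height_append (m n : ℕ) (u v : List Step) :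
    height m n (u ++ v) = height m n u + height m n v := by
  simp only [height, xEnd_append, yEnd_append]; ring

@[simp] theorem height_nil (m n : ℕ) : height m n [] = 0 := by simp [height]

@[simp] theorem xEnd_replicate (k : ℕ) (t : Step) :
    xEnd (List.replicate k t) = k * (t.vec.1 : ℤ) := by
  simp [xEnd, endPoint]
@[simp] theorem yEnd_replicate (k : ℕ) (t : Step) :
    yEnd (List.replicate k t) = k * (t.vec.2 : ℤ) := by
  simp [yEnd, endPoint]

theorem eq_nil_of_end_eq_zero {p : List Step} (hx : xEnd p = 0) (hy : yEnd p = 0) : p = [] := by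
  have h := length_le_endPoint p
  simp only [xEnd, yEnd] at hx hy
  exact List.length_eq_zero_iff.1 (by omega)

theorem eq_replicate_up_of_xEnd_eq_zero {p : List Step} (hx : xEnd p = 0) :
    p = List.replicate (yEnd p).toNat Step.up := by
  induction p with
  | nil => simp
  | cons t p ih =>
    have := xEnd_nonneg p
    have hy := yEnd_nonneg p
    cases t
    · simp at hx; omega
    · simp at hx
      have h1 : (1 + yEnd p).toNat = (yEnd p).toNat + 1 := by omega
      simp only [yEnd_cons, vec_up, Nat.cast_one, h1, List.replicate_succ]
      exact congrArg _ (ih hx)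
    · simp at hx; omega

theorem twiceArea_concat (u : List Step) (t : Step) :
    twiceArea (u ++ [t]) = twiceArea u + (xEnd u * t.vec.2 - t.vec.1 * yEnd u) := by
  have h1 : ∀ k ≤ u.length, point (u ++ [t]) k = point u k := by
    intro k hk
    simp [point, List.take_append_of_le_length hk]
  have h2 : point u u.length = endPoint u := by simp [point]
  have h3 : point (u ++ [t]) (u.length + 1) = endPoint u + t.vec := by
    have : (u ++ [t]).take (u.length + 1) = u ++ [t] := List.take_of_length_le (by simp)
    simp [point, this, endPoint]
  unfold twiceArea
  rw [List.length_append, List.length_singleton, Finset.sum_range_succ]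
  congr 1
  · refine Finset.sum_congr rfl fun k hk => ?_
    rw [Finset.mem_range] at hk
    rw [h1 k hk.le, h1 (k + 1) hk]
  · rw [h1 _ le_rfl, h2, h3]
    simp only [Prod.fst_add, Prod.snd_add, xEnd, yEnd]
    push_cast
    ring

/-- The area of a concatenation: the triangle spanned by the two chords is added. -/
theorem twiceArea_append (u v : List Step) :
    twiceArea (u ++ v) = twiceArea u + twiceArea v + (xEnd u * yEnd v - xEnd v * yEnd u) := by
  induction v using List.reverseRecOn with
  | nil => simp [twiceArea]
  | append_singleton v t ih =>
    rw [← List.append_assoc, twiceArea_concat, ih, twiceArea_concat]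
    simp only [xEnd_append, yEnd_append, xEnd_cons, yEnd_cons, xEnd_nil, yEnd_nil]
    ring

@[simp] theorem twiceArea_nil : twiceArea [] = 0 := by simp [twiceArea]

@[simp] theorem twiceArea_singleton (t : Step) : twiceArea [t] = 0 := by
  simpa using twiceArea_concat [] t

theorem twiceArea_replicate (k : ℕ) (t : Step) : twiceArea (List.replicate k t) = 0 := by
  induction k with
  | zero => simp
  | succ k ih =>
    rw [List.replicate_succ', twiceArea_concat, ih]
    simp
    ring

/-- Summation by parts: for a list of steps all of whose points lie weakly below the line
`y = m x / n`, the region between the path, the line and the vertical line through its end point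
has nonnegative area. -/
theorem twiceArea_add_nonneg {m n : ℕ} (p : List Step)
    (h : ∀ u v, p = u ++ v → 0 ≤ height m n u) :
    0 ≤ n * twiceArea p + xEnd p * height m n p := by
  induction p using List.reverseRecOn with
  | nil => simp
  | append_singleton p t ih =>
    have h1 := ih fun u v huv => h u (v ++ [t]) (by simp [huv])
    have h2 := h p [t] rfl
    have h3 := h (p ++ [t]) [] (by simp)
    rw [twiceArea_concat]
    have key : (n : ℤ) * (twiceArea p + (xEnd p * t.vec.2 - t.vec.1 * yEnd p)) +
        xEnd (p ++ [t]) * height m n (p ++ [t]) =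
        (n * twiceArea p + xEnd p * height m n p) +
          t.vec.1 * (height m n p + height m n (p ++ [t])) := by
      simp only [height, xEnd_append, yEnd_append, xEnd_cons, yEnd_cons, xEnd_nil, yEnd_nil]
      ring
    rw [key]
    positivity

/-! ### The weight of a list of steps and weighted sums -/

section Weight

variable {R : Type*} [CommRing R] (a : R) (q : Rˣ)

/-- The weight `a^i q^j` of a list of steps with `i / 2` diagonal steps and signed area `j / 2`. -/
def weight (p : List Step) : R :=
  a ^ (2 * p.count Step.diag) * ((q ^ twiceArea p : Rˣ) : R)

/-- The sum of the weights of the members of a set of lists of steps (`0` by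
convention if infinitely many weights are nonzero; all sets of interest are finite). -/
noncomputable def weightSum (S : Set (List Step)) : R := ∑ᶠ p ∈ S, weight a q p

theorem weight_append (u v : List Step) : weight a q (u ++ v) =
    ((q ^ (xEnd u * yEnd v - xEnd v * yEnd u) : Rˣ) : R) * (weight a q u * weight a q v) := by
  simp only [weight, twiceArea_append, zpow_add, Units.val_mul, List.count_append, mul_add, pow_add]
  ring

theorem weightSum_singleton (p : List Step) : weightSum a q {p} = weight a q p := by
  simp [weightSum]

theorem weightSum_empty : weightSum a q ∅ = 0 := by
  simp [weightSum]

theorem weightSum_replicate_right (k : ℕ) :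
    weightSum a q {List.replicate k Step.right} = 1 := by
  simp [weightSum_singleton, weight, twiceArea_replicate, List.count_replicate]

theorem weightSum_replicate_up (k : ℕ) : weightSum a q {List.replicate k Step.up} = 1 := by
  simp [weightSum_singleton, weight, twiceArea_replicate, List.count_replicate]

theorem finite_of_end {S : Set (List Step)} {X Y : ℤ}
    (h : ∀ p ∈ S, xEnd p = X ∧ yEnd p = Y) : S.Finite := by
  refine (List.finite_length_le Step (X.toNat + Y.toNat)).subset fun p hp => ?_
  have h1 := length_le_endPoint p
  have h2 := h p hp
  simp only [xEnd, yEnd] at h2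
  simp only [Set.mem_ofPred_eq]
  omega

/-- If every member of `S` factors in exactly one way as a member of some `A i` followed by a
member of `B i`, with prescribed end points, then the weighted sum over `S` is the sum of the
products of those over `A i` and `B i`, corrected by the areas of the triangles spanned by the
chords. -/
theorem weightSum_eq_sum_mul {ι : Type*} (I : Finset ι) (S : Set (List Step))
    (A B : ι → Set (List Step)) (X Y X' Y' : ι → ℤ)
    (hA : ∀ i ∈ I, ∀ u ∈ A i, xEnd u = X i ∧ yEnd u = Y i)
    (hB : ∀ i ∈ I, ∀ v ∈ B i, xEnd v = X' i ∧ yEnd v = Y' i)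
    (hinj : ∀ i ∈ I, ∀ j ∈ I, X i = X j → Y i = Y j → i = j)
    (hmem : ∀ i ∈ I, ∀ u ∈ A i, ∀ v ∈ B i, u ++ v ∈ S)
    (hsplit : ∀ p ∈ S, ∃ i ∈ I, ∃ u ∈ A i, ∃ v ∈ B i, p = u ++ v)
    (huniq : ∀ i ∈ I, ∀ j ∈ I, ∀ u w v, u ∈ A i → w ++ v ∈ B i → u ++ w ∈ A j → v ∈ B j →
      w = []) :
    weightSum a q S = ∑ i ∈ I, ((q ^ (X i * Y' i - X' i * Y i) : Rˣ) : R) *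
      (weightSum a q (A i) * weightSum a q (B i)) := by
  classical
  have hAf : ∀ i ∈ I, (A i).Finite := fun i hi => finite_of_end (hA i hi)
  have hBf : ∀ i ∈ I, (B i).Finite := fun i hi => finite_of_end (hB i hi)
  let fA : ι → Finset (List Step) := fun i => if h : (A i).Finite then h.toFinset else ∅
  let fB : ι → Finset (List Step) := fun i => if h : (B i).Finite then h.toFinset else ∅
  have mA : ∀ i ∈ I, (fA i : Set (List Step)) = A i := fun i hi => by simp [fA, hAf i hi]
  have mB : ∀ i ∈ I, (fB i : Set (List Step)) = B i := fun i hi => by simp [fB, hBf i hi]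
  have mA' : ∀ i ∈ I, ∀ u, u ∈ fA i ↔ u ∈ A i := fun i hi u => by
    rw [← mA i hi, Finset.mem_coe]
  have mB' : ∀ i ∈ I, ∀ u, u ∈ fB i ↔ u ∈ B i := fun i hi u => by
    rw [← mB i hi, Finset.mem_coe]
  let D : Finset (Σ _ : ι, List Step × List Step) := I.sigma fun i => fA i ×ˢ fB i
  let φ : (Σ _ : ι, List Step × List Step) → List Step := fun d => d.2.1 ++ d.2.2
  have hS : S = (D.image φ : Set (List Step)) := by
    ext p
    simp only [Finset.coe_image, Set.mem_image, Finset.mem_coe, D, Finset.mem_sigma,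
      Finset.mem_product, φ]
    constructor
    · intro hp
      obtain ⟨i, hi, u, hu, v, hv, rfl⟩ := hsplit p hp
      exact ⟨⟨i, u, v⟩, ⟨hi, (mA' i hi u).2 hu, (mB' i hi v).2 hv⟩, rfl⟩
    · rintro ⟨⟨i, u, v⟩, ⟨hi, hu, hv⟩, rfl⟩
      exact hmem i hi u ((mA' i hi u).1 hu) v ((mB' i hi v).1 hv)
  have hφ : Set.InjOn φ (D : Set (Σ _ : ι, List Step × List Step)) := by
    rintro ⟨i, u, v⟩ hd ⟨j, u', v'⟩ hd' heq
    simp only [D, Finset.mem_coe, Finset.mem_sigma, Finset.mem_product] at hd hd'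
    obtain ⟨hi, hu, hv⟩ := hd
    obtain ⟨hj, hu', hv'⟩ := hd'
    rw [mA' i hi] at hu
    rw [mB' i hi] at hv
    rw [mA' j hj] at hu'
    rw [mB' j hj] at hv'
    have huu : u = u' ∧ v = v' := by
      rcases List.append_eq_append_iff.1 (show u ++ v = u' ++ v' from heq) with
        ⟨w, rfl, rfl⟩ | ⟨w, rfl, rfl⟩
      · have := huniq i hi j hj u w v' hu hv hu' hv'
        simp [this]
      · have := huniq j hj i hi u' w v hu' hv' hu hv
        simp [this]
    obtain ⟨rfl, rfl⟩ := huu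
    have h1 := hA i hi u hu
    have h2 := hA j hj u hu'
    obtain rfl := hinj i hi j hj (h1.1.symm.trans h2.1) (h1.2.symm.trans h2.2)
    rfl
  rw [weightSum, hS, finsum_mem_coe_finset, Finset.sum_image hφ, Finset.sum_sigma]
  refine Finset.sum_congr rfl fun i hi => ?_
  rw [weightSum, weightSum, ← mA i hi, ← mB i hi, finsum_mem_coe_finset, finsum_mem_coe_finset,
    Finset.sum_mul_sum, Finset.mul_sum, Finset.sum_product]
  refine Finset.sum_congr rfl fun u hu => ?_
  rw [Finset.mul_sum]
  refine Finset.sum_congr rfl fun v hv => ?_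
  obtain ⟨h1, h2⟩ := hA i hi u ((mA' i hi u).1 hu)
  obtain ⟨h3, h4⟩ := hB i hi v ((mB' i hi v).1 hv)
  simp only [φ, weight_append, h1, h2, h3, h4]

/-- The case of a single pair of factors. -/
theorem weightSum_eq_mul (S A B : Set (List Step)) (X Y X' Y' : ℤ)
    (hA : ∀ u ∈ A, xEnd u = X ∧ yEnd u = Y)
    (hB : ∀ v ∈ B, xEnd v = X' ∧ yEnd v = Y')
    (hmem : ∀ u ∈ A, ∀ v ∈ B, u ++ v ∈ S)
    (hsplit : ∀ p ∈ S, ∃ u ∈ A, ∃ v ∈ B, p = u ++ v) :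
    weightSum a q S = ((q ^ (X * Y' - X' * Y) : Rˣ) : R) *
      (weightSum a q A * weightSum a q B) := by
  have := weightSum_eq_sum_mul a q {()} S (fun _ => A) (fun _ => B) (fun _ => X) (fun _ => Y)
    (fun _ => X') (fun _ => Y') (fun _ _ => hA) (fun _ _ => hB) (fun _ _ _ _ _ _ => rfl)
    (fun _ _ => hmem) (fun p hp => ⟨(), by simp, hsplit p hp⟩) ?_
  · simpa using this
  · intro _ _ _ _ u w v hu _ hu' _
    have h1 := hA u hu
    have h2 := hA _ hu'
    rw [xEnd_append, yEnd_append] at h2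
    exact eq_nil_of_end_eq_zero (by omega) (by omega)

end Weight

/-! ### Reversal -/

/-- The step with the coordinates exchanged. -/
def Step.swap : Step → Step
  | .right => .up
  | .up => .right
  | .diag => .diag

/-- The reflection of a path in the anti-diagonal of its bounding box: the steps are reversed and
their coordinates exchanged. It exchanges the roles of `m` and `n`. -/
def reflect (p : List Step) : List Step := (p.map Step.swap).reverse

@[simp] theorem reflect_nil : reflect [] = [] := rfl

@[simp] theorem reflect_append (u v : List Step) :
    reflect (u ++ v) = reflect v ++ reflect u := by
  simp [reflect]

@[simp] theorem reflect_reflect (p : List Step) : reflect (reflect p) = p := by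
  have : Step.swap ∘ Step.swap = id := by funext t; cases t <;> rfl
  simp [reflect, this]

theorem reflect_bijective : Function.Bijective reflect :=
  Function.Involutive.bijective reflect_reflect

theorem xEnd_reflect_and_yEnd_reflect (p : List Step) :
    xEnd (reflect p) = yEnd p ∧ yEnd (reflect p) = xEnd p := by
  induction p with
  | nil => simp
  | cons t p ih =>
    have h : reflect (t :: p) = reflect p ++ [t.swap] := by simp [reflect]
    rw [h]
    cases t <;> simp [ih, Step.swap, add_comm]

@[simp] theorem xEnd_reflect (p : List Step) : xEnd (reflect p) = yEnd p :=
  (xEnd_reflect_and_yEnd_reflect p).1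

@[simp] theorem yEnd_reflect (p : List Step) : yEnd (reflect p) = xEnd p :=
  (xEnd_reflect_and_yEnd_reflect p).2

@[simp] theorem height_reflect (m n : ℕ) (p : List Step) :
    height n m (reflect p) = -height m n p := by
  simp [height]

@[simp] theorem reflect_eq_nil {p : List Step} : reflect p = [] ↔ p = [] := by
  simp [reflect]

theorem twiceArea_reflect (p : List Step) : twiceArea (reflect p) = twiceArea p := by
  induction p with
  | nil => simp
  | cons t p ih =>
    have h : reflect (t :: p) = reflect p ++ [t.swap] := by simp [reflect]
    have h' : t :: p = [t] ++ p := rfl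
    rw [h, h', twiceArea_append, twiceArea_append, ih]
    cases t <;> simp [Step.swap]

theorem count_diag_reflect (p : List Step) :
    (reflect p).count Step.diag = p.count Step.diag := by
  induction p with
  | nil => simp
  | cons t p ih =>
    have h : reflect (t :: p) = reflect p ++ [t.swap] := by simp [reflect]
    rw [h, List.count_append, ih]
    cases t <;> simp [Step.swap]

theorem weightSum_preimage_reflect {R : Type*} [CommRing R] (a : R) (q : Rˣ)
    (S : Set (List Step)) : weightSum a q (reflect ⁻¹' S) = weightSum a q S := by
  rw [weightSum, weightSum]
  refine finsum_mem_eq_of_bijOn reflect ⟨fun p hp => hp, reflect_bijective.1.injOn, ?_⟩ ?_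
  · intro p hp
    exact ⟨reflect p, by simpa using hp, by simp⟩
  · intro p _
    simp [weight, twiceArea_reflect, count_diag_reflect]

/-! ### Sets of paths -/

/-- The paths of size `l` counted by `y^{[s]}`, described through the splittings `p = u ++ v` at
the lattice points of the path. That the path stays weakly below `y = m x / n` is implied, see
`height_nonneg_of_mem_paths`. -/
def paths (m n s l : ℕ) : Set (List Step) :=
  {p | s ≤ m * n * l ∧ (xEnd p = n * l ∧ yEnd p = m * l) ∧
    ∀ u v, p = u ++ v → xEnd v ≠ 0 → yEnd u ≠ 0 → (s : ℤ) ≤ height m n u}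

/-- Paths from the origin to `(X, Y)` whose points before the last one, other than those on the
`x`-axis, lie strictly below the line of slope `m / n` through `(X, Y)`. -/
def arrivals (m n : ℕ) (X Y : ℤ) : Set (List Step) :=
  {p | (xEnd p = X ∧ yEnd p = Y) ∧
    ∀ u v, p = u ++ v → v ≠ [] → yEnd u ≠ 0 → height m n v < 0}

/-- Paths from the origin to `(X, Y)` whose points after the first one, other than those with
`x`-coordinate `X`, lie strictly below the line of slope `m / n` through the origin. -/
def departures (m n : ℕ) (X Y : ℤ) : Set (List Step) :=
  {p | (xEnd p = X ∧ yEnd p = Y) ∧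
    ∀ u v, p = u ++ v → u ≠ [] → xEnd v ≠ 0 → 0 < height m n u}

/-- Paths from the origin to `(X, Y)` whose points, other than those with `x`-coordinate `X`, lie
weakly below the line of slope `m / n` through the origin. -/
def tails (m n : ℕ) (X Y : ℤ) : Set (List Step) :=
  {p | (xEnd p = X ∧ yEnd p = Y) ∧
    ∀ u v, p = u ++ v → xEnd v ≠ 0 → 0 ≤ height m n u}

theorem height_of_mem_paths {m n s l : ℕ} {p : List Step} (hp : p ∈ paths m n s l) :
    height m n p = 0 := by
  rw [height, hp.2.1.1, hp.2.1.2]; ring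

theorem height_nonneg_of_mem_paths {m n s l : ℕ} {p u v : List Step} (hp : p ∈ paths m n s l)
    (h : p = u ++ v) : 0 ≤ height m n u := by
  by_cases hy : yEnd u = 0
  · have := xEnd_nonneg u
    rw [height, hy]
    simp only [mul_zero, sub_zero]
    positivity
  by_cases hx : xEnd v = 0
  · have h1 := height_of_mem_paths hp
    rw [h, height_append, height, height, hx] at h1
    have h2 : 0 ≤ (n : ℤ) * yEnd v := mul_nonneg (by positivity) (yEnd_nonneg v)
    rw [height]
    linarith
  · exact le_trans (by positivity) (hp.2.2 u v h hx hy)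

theorem forall_point_iff {p : List Step} {C : List Step → Prop} :
    (∀ k ≤ p.length, C (p.take k)) ↔ ∀ u v, p = u ++ v → C u := by
  constructor
  · rintro h u v rfl
    simpa using h u.length (by simp)
  · intro h k _
    exact h _ _ (List.take_append_drop k p).symm

theorem mem_paths_iff {m n s l : ℕ} {p : List Step} :
    p ∈ paths m n s l ↔ s ≤ m * n * l ∧ IsPath m n l p ∧ MidwayBelow m n s l p := by
  have hend : endPoint p = (n * l, m * l) ↔ xEnd p = n * l ∧ yEnd p = m * l := by
    rw [Prod.ext_iff, xEnd, yEnd]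
    norm_cast
  have hmid : MidwayBelow m n s l p ↔ ∀ u v, p = u ++ v → xEnd u ≠ n * l → yEnd u ≠ 0 →
      (n : ℤ) * yEnd u ≤ m * xEnd u - s := by
    rw [← forall_point_iff (C := fun u => xEnd u ≠ n * l → yEnd u ≠ 0 →
      (n : ℤ) * yEnd u ≤ m * xEnd u - s)]
    simp only [MidwayBelow, point, xEnd, yEnd]
    norm_cast
  have hx : ∀ u v, p = u ++ v → xEnd p = n * l → (xEnd v ≠ 0 ↔ xEnd u ≠ n * l) := by
    rintro u v rfl h
    rw [xEnd_append] at h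
    constructor <;> intro h1 h2 <;> apply h1 <;> omega
  constructor
  · intro hp
    refine ⟨hp.1, ⟨hend.2 hp.2.1, ?_⟩, ?_⟩
    · have := (forall_point_iff (p := p)
        (C := fun u => n * (endPoint u).2 ≤ m * (endPoint u).1)).2 fun u v huv => by
          have := height_nonneg_of_mem_paths hp huv
          rw [height, xEnd, yEnd] at this
          zify
          linarith
      exact this
    · rw [hmid]
      intro u v huv h1 h2
      have := hp.2.2 u v huv ((hx u v huv hp.2.1.1).2 h1) h2
      rw [height] at this
      linarith
  · rintro ⟨h1, ⟨h2, -⟩, h3⟩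
    rw [hmid] at h3
    refine ⟨h1, hend.1 h2, fun u v huv h4 h5 => ?_⟩
    have := h3 u v huv ((hx u v huv (hend.1 h2).1).1 h4) h5
    rw [height]
    linarith

theorem finite_paths (m n s l : ℕ) : (paths m n s l).Finite := finite_of_end fun _ hp => hp.2.1

theorem twiceArea_nonneg_of_mem_paths {m n s l : ℕ} (hn : 0 < n) {p : List Step}
    (hp : p ∈ paths m n s l) : 0 ≤ twiceArea p := by
  have h := twiceArea_add_nonneg (m := m) (n := n) p
    fun u v huv => height_nonneg_of_mem_paths hp huv
  rw [height_of_mem_paths hp, mul_zero, add_zero] at h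
  exact nonneg_of_mul_nonneg_right h (by exact_mod_cast hn)

/-- The coefficients of `y^{[s]}` are the weighted sums over the paths. -/
theorem coeff_genFun {R : Type*} [CommRing R] (a : R) (q : Rˣ) {m n : ℕ} (hn : 0 < n) (s l : ℕ) :
    PowerSeries.coeff l (genFun m n a q s) = weightSum a q (paths m n s l) := by
  classical
  have hfin := finite_paths m n s l
  let P := hfin.toFinset
  let g : List Step → ℕ × ℕ := fun p => (2 * p.count Step.diag, (twiceArea p).toNat)
  have hP : ∀ p, p ∈ P ↔ p ∈ paths m n s l := fun p => hfin.mem_toFinset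
  have hcount : ∀ ij : ℕ × ℕ, pathCount m n s ij.1 ij.2 l = (P.filter (g · = ij)).card := by
    intro ij
    rw [pathCount, ← Set.ncard_coe_finset]
    congr 1
    ext p
    simp only [countedPaths, Set.mem_ofPred_eq, Finset.coe_filter, hP, g, Prod.ext_iff]
    constructor
    · rintro ⟨h1, h2, h3, h4, h5⟩
      exact ⟨mem_paths_iff.2 ⟨h1, h2, h3⟩, h4, by simp [h5]⟩
    · rintro ⟨h, h4, h5⟩
      obtain ⟨h1, h2, h3⟩ := mem_paths_iff.1 h
      have := twiceArea_nonneg_of_mem_paths hn h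
      exact ⟨h1, h2, h3, h4, by omega⟩
  rw [genFun, PowerSeries.coeff_mk,
    finsum_eq_sum_of_support_subset (s := P.image g), weightSum, ← hfin.coe_toFinset,
    finsum_mem_coe_finset]
  · rw [← Finset.sum_fiberwise_of_maps_to (s := P) (t := P.image g) (g := g)
      (fun p hp => Finset.mem_image_of_mem g hp)]
    refine Finset.sum_congr rfl fun ij _ => ?_
    rw [hcount, mul_assoc, ← nsmul_eq_mul]
    refine (Finset.sum_eq_card_nsmul fun p hp => ?_).symm
    rw [Finset.mem_filter] at hp
    obtain ⟨hp, rfl⟩ := hp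
    have h := twiceArea_nonneg_of_mem_paths hn ((hP p).1 hp)
    have h' : twiceArea p = ((twiceArea p).toNat : ℤ) := by omega
    simp only [weight, g]
    conv_lhs => rw [h', zpow_natCast, Units.val_pow_eq_pow_val]
  · intro ij hij
    rw [Function.mem_support] at hij
    have : pathCount m n s ij.1 ij.2 l ≠ 0 := fun h => hij (by simp [h])
    rw [hcount, Finset.card_ne_zero] at this
    obtain ⟨p, hp⟩ := this
    rw [Finset.mem_filter] at hp
    exact Finset.mem_coe.2 (Finset.mem_image.2 ⟨p, hp⟩)

theorem paths_zero_right {m n s : ℕ} (hs : 0 < s) : paths m n s 0 = ∅ := by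
  ext p
  simp only [Set.mem_empty_iff_false, iff_false]
  intro hp
  have := hp.1
  simp at this
  omega

theorem paths_zero_zero (m n : ℕ) : paths m n 0 0 = {[]} := by
  ext p
  rw [Set.mem_singleton_iff]
  constructor
  · intro hp
    have := hp.2.1
    exact eq_nil_of_end_eq_zero (by simpa using this.1) (by simpa using this.2)
  · rintro rfl
    refine ⟨by simp, by simp, ?_⟩
    intro u v huv h
    obtain ⟨rfl, rfl⟩ := List.nil_eq_append_iff.1 huv
    simp at h

theorem reflect_preimage_paths (m n s l : ℕ) :
    reflect ⁻¹' paths n m s l = paths m n s l := by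
  ext p
  simp only [Set.mem_preimage, paths, Set.mem_ofPred_eq, xEnd_reflect, yEnd_reflect]
  rw [mul_comm n m, and_comm (a := yEnd p = _)]
  refine and_congr_right fun _ => and_congr_right fun he => ?_
  have h0 : height m n p = 0 := by rw [height, he.1, he.2]; ring
  constructor
  · rintro h u v rfl hv hu
    have := h (reflect v) (reflect u) (by simp) (by simpa) (by simpa)
    rw [height_reflect] at this
    rw [height_append] at h0
    linarith
  · intro h u v huv hv hu
    have hp : p = reflect v ++ reflect u := by rw [← reflect_append, ← huv, reflect_reflect]
    have := h (reflect v) (reflect u) hp (by simpa) (by simpa)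
    rw [hp, height_append, height_reflect, height_reflect] at h0
    rw [height_reflect] at this
    have e := height_reflect m n (reflect u)
    rw [reflect_reflect] at e
    have e' := height_reflect n m u
    linarith

theorem reflect_preimage_arrivals (m n : ℕ) (X Y : ℤ) :
    reflect ⁻¹' arrivals n m Y X = departures m n X Y := by
  ext p
  simp only [Set.mem_preimage, arrivals, departures, Set.mem_ofPred_eq, xEnd_reflect, yEnd_reflect]
  rw [and_comm (a := yEnd p = _)]
  refine and_congr_right fun _ => ?_
  constructor
  · rintro h u v rfl hu hv
    have := h (reflect v) (reflect u) (by simp) (by simpa) (by simpa)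
    rw [height_reflect] at this
    linarith
  · intro h u v huv hv hu
    have hp : p = reflect v ++ reflect u := by rw [← reflect_append, ← huv, reflect_reflect]
    have := h (reflect v) (reflect u) hp (by simpa) (by simpa)
    rw [height_reflect] at this
    linarith

/-! ### First and last splittings -/

theorem exists_first_split {C : List Step → List Step → Prop} {p : List Step}
    (h : ∃ u v, p = u ++ v ∧ C u v) :
    ∃ u v, p = u ++ v ∧ C u v ∧ ∀ u' w, u = u' ++ w → w ≠ [] → ¬ C u' (w ++ v) := by
  obtain ⟨u, v, hp, hC⟩ := h
  induction hk : u.length using Nat.strong_induction_on generalizing u v with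
  | _ k ih =>
    by_cases hex : ∃ u' w, u = u' ++ w ∧ w ≠ [] ∧ C u' (w ++ v)
    · obtain ⟨u', w, rfl, hw, hC'⟩ := hex
      refine ih u'.length ?_ u' (w ++ v) (by simpa using hp) hC' rfl
      have := List.length_pos_iff.2 hw
      rw [← hk, List.length_append]
      omega
    · exact ⟨u, v, hp, hC, fun u' w h1 h2 h3 => hex ⟨u', w, h1, h2, h3⟩⟩

theorem exists_last_split {C : List Step → List Step → Prop} {p : List Step}
    (h : ∃ u v, p = u ++ v ∧ C u v) :
    ∃ u v, p = u ++ v ∧ C u v ∧ ∀ w v', v = w ++ v' → w ≠ [] → ¬ C (u ++ w) v' := by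
  obtain ⟨u, v, hp, hC⟩ := h
  induction hk : v.length using Nat.strong_induction_on generalizing u v with
  | _ k ih =>
    by_cases hex : ∃ w v', v = w ++ v' ∧ w ≠ [] ∧ C (u ++ w) v'
    · obtain ⟨w, v', rfl, hw, hC'⟩ := hex
      refine ih v'.length ?_ (u ++ w) v' (by simpa using hp) hC' rfl
      have := List.length_pos_iff.2 hw
      rw [← hk, List.length_append]
      omega
    · exact ⟨u, v, hp, hC, fun w v' h1 h2 h3 => hex ⟨w, v', h1, h2, h3⟩⟩

/-! ### Decomposition at the last touching point -/

/-- A lattice point on `m x = n y` is an integral multiple of `(n, m)`. -/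
theorem eq_mul_of_coprime {m n : ℕ} (hn : 0 < n) (h : Nat.Coprime m n) {x y : ℤ}
    (hxy : (m : ℤ) * x = n * y) : ∃ k : ℤ, x = n * k ∧ y = m * k := by
  obtain ⟨k, rfl⟩ : (n : ℤ) ∣ x :=
    (Nat.isCoprime_iff_coprime.2 h.symm).dvd_of_dvd_mul_left (Dvd.intro _ hxy.symm)
  refine ⟨k, rfl, ?_⟩
  have hn' : (n : ℤ) ≠ 0 := by exact_mod_cast hn.ne'
  apply mul_left_cancel₀ hn'
  linarith [hxy, mul_left_comm (m : ℤ) n k]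

section Decomposition

variable {R : Type*} [CommRing R] (a : R) (q : Rˣ)

/-- A path weakly below a line through the origin is cut at the last point where it touches that
line. -/
theorem weightSum_tails {m n : ℕ} (hn : 0 < n) (hmn : Nat.Coprime m n) {X Y : ℤ} (hX : 0 < X)
    (I : Finset ℕ) (hI : ∀ k : ℕ, k ∈ I ↔ (n : ℤ) * k < X) :
    weightSum a q (tails m n X Y) = ∑ k ∈ I, ((q ^ (((m : ℤ) * X - n * Y) * -k) : Rˣ) : R) *
      (weightSum a q (paths m n 0 k) * weightSum a q (departures m n (X - n * k) (Y - m * k))) := by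
  have hn' : (0 : ℤ) < n := by exact_mod_cast hn
  rw [weightSum_eq_sum_mul a q I (tails m n X Y) (fun k => paths m n 0 k)
    (fun k => departures m n (X - n * k) (Y - m * k)) (fun k => n * k) (fun k => m * k)
    (fun k => X - n * k) (fun k => Y - m * k) (fun k _ u hu => hu.2.1) (fun k _ v hv => hv.1)]
  · refine Finset.sum_congr rfl fun k _ => ?_
    congr 4
    ring
  · intro i _ j _ hij _
    exact_mod_cast mul_left_cancel₀ hn'.ne' hij
  · intro k hk u hu v hv
    rw [hI] at hk
    refine ⟨⟨?_, ?_⟩, ?_⟩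
    · rw [xEnd_append, hu.2.1.1, hv.1.1]; ring
    · rw [yEnd_append, hu.2.1.2, hv.1.2]; ring
    · intro c d hcd hd
      rcases List.append_eq_append_iff.1 hcd with ⟨w, rfl, rfl⟩ | ⟨w, rfl, rfl⟩
      · rw [height_append, height_of_mem_paths hu, zero_add]
        by_cases hw : w = []
        · simp [hw]
        · exact (hv.2 w d rfl hw hd).le
      · exact height_nonneg_of_mem_paths hu rfl
  · intro p hp
    obtain ⟨u, v, rfl, ⟨hu, hv⟩, hlast⟩ := exists_last_split
      (C := fun u v => height m n u = 0 ∧ xEnd v ≠ 0) (p := p)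
      ⟨[], p, rfl, by simp, by rw [hp.1.1]; omega⟩
    have hu' : (m : ℤ) * xEnd u = n * yEnd u := by rw [height] at hu; linarith
    obtain ⟨k, hk1, hk2⟩ := eq_mul_of_coprime hn hmn hu'
    have hk0 : 0 ≤ k := by
      have := xEnd_nonneg u
      rw [hk1] at this
      exact nonneg_of_mul_nonneg_right this hn'
    lift k to ℕ using hk0
    have hX' := hp.1.1
    have hY' := hp.1.2
    rw [xEnd_append] at hX'
    rw [yEnd_append] at hY'
    have hv0 := xEnd_nonneg v
    refine ⟨k, (hI k).2 (by omega), u, ⟨by simp, ⟨hk1, hk2⟩, ?_⟩, v,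
      ⟨⟨by omega, by omega⟩, ?_⟩, rfl⟩
    · rintro c d rfl hd _
      have := xEnd_nonneg d
      exact_mod_cast hp.2 c (d ++ v) (by simp) (by rw [xEnd_append]; omega)
    · rintro c d rfl hc hd
      have h1 := hp.2 (u ++ c) d (by simp) hd
      have h2 := hlast c d rfl hc
      rw [height_append, hu, zero_add] at h1
      rw [height_append, hu, zero_add] at h2
      exact lt_of_le_of_ne h1 fun h => h2 ⟨h.symm, hd⟩
  · intro i hi j hj u w v hu hwv huw hv
    by_contra hw
    rw [hI] at hj
    have h1 := hwv.2 w v rfl hw (by rw [hv.1.1]; omega)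
    have h2 := height_of_mem_paths huw
    rw [height_append, height_of_mem_paths hu] at h2
    omega

theorem tails_eq_paths (m n l : ℕ) : tails m n (n * l) (m * l) = paths m n 0 l := by
  ext p
  constructor
  · intro hp
    exact ⟨by simp, hp.1, fun u v huv hv _ => by exact_mod_cast hp.2 u v huv hv⟩
  · intro hp
    exact ⟨hp.2.1, fun u v huv _ => height_nonneg_of_mem_paths hp huv⟩

theorem departures_eq_paths {m n l : ℕ} (hm : 0 < m) (hn : 0 < n) (hl : 0 < l) :
    departures m n (n * l) (m * l) = paths m n 1 l := by
  have hm' : (0 : ℤ) < m := by exact_mod_cast hm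
  ext p
  constructor
  · intro hp
    refine ⟨Nat.mul_pos (Nat.mul_pos hm hn) hl, hp.1, fun u v huv hv hu => ?_⟩
    have := hp.2 u v huv (by rintro rfl; simp at hu) hv
    push_cast
    omega
  · intro hp
    refine ⟨hp.2.1, fun u v huv hu hv => ?_⟩
    by_cases hy : yEnd u = 0
    · have hx : xEnd u ≠ 0 := fun hx => hu (eq_nil_of_end_eq_zero hx hy)
      have hx' : 0 < xEnd u := lt_of_le_of_ne (xEnd_nonneg u) hx.symm
      rw [height, hy, mul_zero, sub_zero]
      positivity
    · have := hp.2.2 u v huv hv hy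
      push_cast at this
      omega

/-- A nonempty path is cut at its last point before the end on the line `y = m x / n`. -/
theorem weightSum_paths_zero {m n : ℕ} (hm : 0 < m) (hn : 0 < n) (hmn : Nat.Coprime m n) {l : ℕ}
    (hl : 0 < l) : weightSum a q (paths m n 0 l) = ∑ k ∈ Finset.range l,
      weightSum a q (paths m n 0 k) * weightSum a q (paths m n 1 (l - k)) := by
  have hn' : (0 : ℤ) < n := by exact_mod_cast hn
  rw [← tails_eq_paths, weightSum_tails a q hn hmn (by positivity) (Finset.range l)]
  · refine Finset.sum_congr rfl fun k hk => ?_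
    rw [Finset.mem_range] at hk
    have h1 : (n : ℤ) * l - n * k = n * (l - k : ℕ) := by push_cast [hk.le]; ring
    have h2 : (m : ℤ) * l - m * k = m * (l - k : ℕ) := by push_cast [hk.le]; ring
    have h3 : ((m : ℤ) * (n * l) - n * (m * l)) * -k = 0 := by ring
    rw [h1, h2, h3, departures_eq_paths hm hn (by omega)]
    simp
  · intro k
    rw [Finset.mem_range, mul_lt_mul_iff_right₀ hn']
    norm_cast

/-! ### Normalising the outer pieces -/

/-- Moving the end point of an arrival to the right only adds horizontal steps at the start. -/
theorem weightSum_arrivals_add_one {m n : ℕ} {X Y : ℤ} (hX : 0 < X) (hY : 0 < Y)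
    (h : (n : ℤ) * (Y - 1) ≤ m * X) : weightSum a q (arrivals m n (X + 1) Y) =
      ((q ^ Y : Rˣ) : R) * weightSum a q (arrivals m n X Y) := by
  have hm : (0 : ℤ) ≤ m := by positivity
  rw [weightSum_eq_mul a q (arrivals m n (X + 1) Y) {List.replicate 1 Step.right}
    (arrivals m n X Y) 1 0 X Y, weightSum_replicate_right]
  · simp
  · simp
  · exact fun _ hv => hv.1
  · rintro u rfl v hv
    refine ⟨⟨?_, ?_⟩, ?_⟩
    · simp [hv.1.1, add_comm]
    · simp [hv.1.2]
    · intro c d hcd hd hc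
      cases c with
      | nil => simp at hc
      | cons t c =>
        simp only [List.replicate_one, List.cons_append, List.nil_append,
          List.cons.injEq] at hcd
        obtain ⟨rfl, rfl⟩ := hcd
        exact hv.2 c d rfl hd (by simpa using hc)
  · intro p hp
    cases p with
    | nil => have := hp.1.2; simp at this; omega
    | cons t p =>
      have hx := hp.1.1
      have hy := hp.1.2
      -- A first step that leaves the `x`-axis would put the path above the line through its end.
      have key : t.vec.2 = 1 → p ≠ [] → height m n p < 0 := fun ht hne =>
        hp.2 [t] p rfl hne (by simp [ht])
      cases t with
      | right =>
        simp at hx hy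
        refine ⟨_, rfl, p, ⟨⟨by omega, hy⟩, fun c d hcd hd hc => ?_⟩, rfl⟩
        exact hp.2 (Step.right :: c) d (by simp [hcd]) hd (by simpa using hc)
      | up =>
        exfalso
        simp at hx hy
        have := key rfl (by rintro rfl; simp at hx; omega)
        rw [height, hx, show yEnd p = Y - 1 by omega] at this
        linarith
      | diag =>
        exfalso
        simp at hx hy
        have := key rfl (by rintro rfl; simp at hx; omega)
        rw [height, show xEnd p = X by omega, show yEnd p = Y - 1 by omega] at this
        linarith

theorem weightSum_arrivals_add_nat {m n : ℕ} {X Y : ℤ} (hX : 0 < X) (hY : 0 < Y)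
    (h : (n : ℤ) * (Y - 1) ≤ m * X) (d : ℕ) : weightSum a q (arrivals m n (X + d) Y) =
      ((q ^ (d * Y) : Rˣ) : R) * weightSum a q (arrivals m n X Y) := by
  induction d with
  | zero => simp
  | succ d ih =>
    have h1 : (m : ℤ) * X ≤ m * (X + d) := by
      apply mul_le_mul_of_nonneg_left <;> linarith [Int.natCast_nonneg d, Int.natCast_nonneg m]
    rw [show X + ((d + 1 : ℕ) : ℤ) = X + d + 1 by push_cast; ring,
      weightSum_arrivals_add_one a q (by positivity) hY (h.trans h1), ih, ← mul_assoc,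
      ← Units.val_mul, ← zpow_add]
    congr 4
    push_cast
    ring

theorem weightSum_arrivals_eq {m n : ℕ} {X X' Y : ℤ} (hX : 0 < X) (hX' : 0 < X') (hY : 0 < Y)
    (h : (n : ℤ) * (Y - 1) ≤ m * X) (h' : (n : ℤ) * (Y - 1) ≤ m * X') :
    weightSum a q (arrivals m n X' Y) =
      ((q ^ ((X' - X) * Y) : Rˣ) : R) * weightSum a q (arrivals m n X Y) := by
  rcases le_total X X' with hle | hle
  · obtain ⟨d, hd⟩ := Int.le.dest hle
    rw [← hd, weightSum_arrivals_add_nat a q hX hY h d]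
    congr 4
    ring
  · obtain ⟨d, hd⟩ := Int.le.dest hle
    rw [← hd, weightSum_arrivals_add_nat a q hX' hY h' d, ← mul_assoc, ← Units.val_mul,
      ← zpow_add]
    ring_nf
    simp

/-- A path whose midway points lie strictly below `y = m x / n - β` ends with `β` vertical
steps. -/
theorem weightSum_paths_eq_arrivals {m n β l : ℕ} (hβ : β < m) (hn : 0 < n) (hl : 0 < l) :
    weightSum a q (paths m n (β * n + 1) l) =
      ((q ^ ((n : ℤ) * l * β) : Rˣ) : R) *
        weightSum a q (arrivals m n (n * l) (m * l - β)) := by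
  have hn' : (0 : ℤ) < n := by exact_mod_cast hn
  have hl' : (1 : ℤ) ≤ l := by exact_mod_cast hl
  have hβ' : (β : ℤ) < m := by exact_mod_cast hβ
  have hml : (m : ℤ) ≤ m * l := le_mul_of_one_le_right (by positivity) hl'
  have hnl : (0 : ℤ) < n * l := by positivity
  rw [weightSum_eq_mul a q (paths m n (β * n + 1) l) (arrivals m n (n * l) (m * l - β))
    {List.replicate β Step.up} (n * l) (m * l - β) 0 β, weightSum_replicate_up]
  · simp
  · exact fun _ hu => hu.1
  · simp
  · rintro u hu v rfl
    refine ⟨?_, ⟨by simp [hu.1.1], by simp [hu.1.2]⟩, ?_⟩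
    · calc β * n + 1 ≤ (β + 1) * n := by linarith
        _ ≤ m * n := Nat.mul_le_mul_right _ hβ
        _ ≤ m * n * l := Nat.le_mul_of_pos_right _ hl
    · intro c d hcd hd hc
      rcases List.append_eq_append_iff.1 hcd with ⟨w, rfl, hw⟩ | ⟨w, rfl, rfl⟩
      · exfalso
        have h1 := congrArg xEnd hw
        simp at h1
        have := xEnd_nonneg w
        have := xEnd_nonneg d
        omega
      · have h1 := hu.2 c w rfl (by rintro rfl; simp at hd) hc
        have h2 : height m n c + height m n w = n * β := by
          rw [← height_append, height, hu.1.1, hu.1.2]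
          ring
        push_cast
        linarith
  · intro p hp
    have hpx := hp.2.1.1
    have hpy := hp.2.1.2
    have strip : ∀ j ≤ β, ∃ u, p = u ++ List.replicate j Step.up := by
      intro j
      induction j with
      | zero => exact fun _ => ⟨p, by simp⟩
      | succ j ih =>
        intro hj
        obtain ⟨u, rfl⟩ := ih (by omega)
        have hj' : (j : ℤ) + 1 ≤ β := by exact_mod_cast hj
        have hnj : (n : ℤ) * (j + 1) ≤ β * n := by
          rw [mul_comm]; exact mul_le_mul_of_nonneg_right hj' hn'.le
        rcases List.eq_nil_or_concat u with rfl | ⟨c, t, rfl⟩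
        · simp at hpx
          omega
        · rw [List.concat_eq_append] at hpx hpy hp ⊢
          have key := hp.2.2 c ([t] ++ List.replicate j Step.up) (by simp)
          cases t with
          | right =>
            exfalso
            simp at hpx hpy key
            have := key (by omega)
            rw [height, show xEnd c = n * l - 1 by omega,
              show yEnd c = m * l - j by omega] at this
            nlinarith
          | up => exact ⟨c, by simp [List.replicate_succ]⟩
          | diag =>
            exfalso
            simp at hpx hpy key
            have := key (by omega)
            rw [height, show xEnd c = n * l - 1 by omega,
              show yEnd c = m * l - (j + 1) by omega] at this
            nlinarith
    obtain ⟨u, rfl⟩ := strip β le_rfl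
    simp at hpx hpy
    refine ⟨u, ⟨⟨hpx, by omega⟩, ?_⟩, _, rfl, rfl⟩
    rintro c w rfl hw hc
    rw [xEnd_append] at hpx
    rw [yEnd_append] at hpy
    by_cases hxw : xEnd w = 0
    · have : yEnd w ≠ 0 := fun hyw => hw (eq_nil_of_end_eq_zero hxw hyw)
      have h1 : 0 < yEnd w := lt_of_le_of_ne (yEnd_nonneg w) this.symm
      rw [height, hxw]
      nlinarith
    · have h1 := hp.2.2 c (w ++ List.replicate β Step.up) (by simp) (by simpa) hc
      have h2 : height m n c + height m n w = n * β := by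
        rw [← height_append, height, xEnd_append, yEnd_append, hpx,
          show yEnd c + yEnd w = m * l - β by omega]
        ring
      push_cast at h1
      linarith

/-- The pieces of paths up to the first touching point of the line `y = (m x - s) / n`, where
`s = α m + β n - m n ε`, in terms of the paths counted by `y^{[β n + 1]}`. -/
theorem weightSum_arrivals_eq_paths {m n α β l : ℕ} {ε : ℤ} (hm : 0 < m) (hn : 0 < n)
    (hβ : β < m) (hl : 0 < l) (hs : 0 < (α : ℤ) * m + β * n - m * n * ε) :
    weightSum a q (arrivals m n (n * (l - ε) + α) (m * l - β)) =
      ((q ^ ((α - n * ε) * (m * l - β) - n * l * β) : Rˣ) : R) *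
        weightSum a q (paths m n (β * n + 1) l) := by
  have hn' : (0 : ℤ) < n := by exact_mod_cast hn
  have hm' : (0 : ℤ) < m := by exact_mod_cast hm
  have hl' : (1 : ℤ) ≤ l := by exact_mod_cast hl
  have hβ' : (β : ℤ) < m := by exact_mod_cast hβ
  have hml : (m : ℤ) ≤ m * l := le_mul_of_one_le_right (by positivity) hl'
  have hY : (0 : ℤ) < m * l - β := by linarith
  have hnβ : (0 : ℤ) ≤ n * β := by positivity
  have e : (m : ℤ) * (n * (l - ε) + α) = α * m + β * n - m * n * ε + n * (m * l - β) := by ring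
  have hX : (0 : ℤ) < n * (l - ε) + α := by
    have : (0 : ℤ) < m * (n * (l - ε) + α) := by rw [e]; positivity
    exact pos_of_mul_pos_right this hm'.le
  rw [weightSum_paths_eq_arrivals a q hβ hn hl,
    weightSum_arrivals_eq a q (X := n * l) (by positivity) hX hY (by nlinarith) (by nlinarith),
    ← mul_assoc, ← Units.val_mul, ← zpow_add]
  congr 4
  ring

/-- The mirror image of `weightSum_arrivals_eq_paths` for the pieces after the last touching
point. -/
theorem weightSum_departures_eq_paths {m n α β l : ℕ} {ε : ℤ} (hm : 0 < m) (hn : 0 < n)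
    (hα : α < n) (hl : 0 < l) (hs : 0 < (α : ℤ) * m + β * n - m * n * ε) :
    weightSum a q (departures m n (n * l - α) (m * (l - ε) + β)) =
      ((q ^ ((β - m * ε) * (n * l - α) - m * l * α) : Rˣ) : R) *
        weightSum a q (paths m n (α * m + 1) l) := by
  rw [← reflect_preimage_arrivals, weightSum_preimage_reflect, ← reflect_preimage_paths,
    weightSum_preimage_reflect, weightSum_arrivals_eq_paths a q hn hm hα hl]
  convert hs using 1
  ring

end Decomposition

/-! ### The recursions for the weighted sums -/

section Recursion

variable {R : Type*} [CommRing R] (a : R) (q : Rˣ)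

/-- The pieces after the first touching point of the line `y = (m x - s) / n`, where
`s = α m + β n - m n ε`, are cut at the last touching point. -/
theorem weightSum_tails_eq_sum {m n α β L : ℕ} {ε : ℤ} (hm : 0 < m) (hn : 0 < n)
    (hmn : Nat.Coprime m n) (hα : α < n) (hL : 0 < L)
    (hs : 0 < (α : ℤ) * m + β * n - m * n * ε) :
    weightSum a q (tails m n (n * L - α) (m * (L - ε) + β)) =
      ∑ k ∈ Finset.range L, ((q ^ (((α : ℤ) * m + β * n - m * n * ε) * k +
          ((β - m * ε) * (n * (L - k : ℕ) - α) - m * (L - k : ℕ) * α)) : Rˣ) : R) *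
        (weightSum a q (paths m n 0 k) * weightSum a q (paths m n (α * m + 1) (L - k))) := by
  have hn' : (0 : ℤ) < n := by exact_mod_cast hn
  have hL' : (1 : ℤ) ≤ L := by exact_mod_cast hL
  have hα' : (α : ℤ) < n := by exact_mod_cast hα
  have hnL : (n : ℤ) ≤ n * L := le_mul_of_one_le_right hn'.le hL'
  rw [weightSum_tails a q hn hmn (by linarith) (Finset.range L)]
  · refine Finset.sum_congr rfl fun k hk => ?_
    rw [Finset.mem_range] at hk
    have h1 : (n : ℤ) * L - α - n * k = n * (L - k : ℕ) - α := by push_cast [hk.le]; ring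
    have h2 : (m : ℤ) * (L - ε) + β - m * k = m * ((L - k : ℕ) - ε) + β := by
      push_cast [hk.le]; ring
    rw [h1, h2, weightSum_departures_eq_paths a q hm hn hα (by omega) hs, zpow_add, Units.val_mul]
    rw [show ((m : ℤ) * (n * L - α) - n * (m * (L - ε) + β)) * -k =
      ((α : ℤ) * m + β * n - m * n * ε) * k by ring]
    ring
  · intro k
    rw [Finset.mem_range]
    constructor
    · intro h
      have h' : (k : ℤ) + 1 ≤ L := by exact_mod_cast h
      nlinarith
    · intro h
      have : (n : ℤ) * k < n * L := by linarith [Int.natCast_nonneg α]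
      exact_mod_cast lt_of_mul_lt_mul_left this hn'.le

/-- The paths counted by `y^{[s]}` but not by `y^{[s+1]}` are those with a midway point on the line
`y = (m x - s) / n`; they are cut at the first such point. -/
theorem weightSum_paths_eq_add {m n α β s l N : ℕ} {ε : ℤ} (hn : 0 < n)
    (hmn : Nat.Coprime m n) (hα : α < n) (hβ : β < m) (hs0 : 0 < s) (hsmn : s < m * n)
    (hs : (s : ℤ) = (α : ℤ) * m + β * n - m * n * ε) (hN : (N : ℤ) = l + ε) :
    weightSum a q (paths m n s l) = weightSum a q (paths m n (s + 1) l) +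
      ∑ i ∈ Finset.Ico 1 N, ((q ^ ((s : ℤ) * (N - ε)) : Rˣ) : R) *
        (weightSum a q (arrivals m n (n * (i - ε) + α) (m * i - β)) *
          weightSum a q (tails m n (n * (N - i : ℕ) - α) (m * ((N - i : ℕ) - ε) + β))) := by
  have hn' : (0 : ℤ) < n := by exact_mod_cast hn
  have hm' : (0 : ℤ) < m := by exact_mod_cast (by omega : 0 < m)
  have hβ' : (β : ℤ) < m := by exact_mod_cast hβ
  have hα' : (α : ℤ) < n := by exact_mod_cast hα
  have hsub : paths m n (s + 1) l ⊆ paths m n s l := fun p hp =>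
    ⟨by have := hp.1; omega, hp.2.1, fun u v h hv hu => by
      have := hp.2.2 u v h hv hu
      push_cast at this
      omega⟩
  have hdiff : weightSum a q (paths m n s l) = weightSum a q (paths m n (s + 1) l) +
      weightSum a q (paths m n s l \ paths m n (s + 1) l) := by
    rw [weightSum, weightSum, weightSum, finsum_mem_add_sdiff hsub (finite_paths m n s l)]
  have hheight : ∀ i : ℕ, ∀ u ∈ arrivals m n (n * (i - ε) + α) (m * i - β),
      height m n u = s := by
    intro i u hu
    rw [height, hu.1.1, hu.1.2, hs]
    ring
  rw [hdiff]
  congr 1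
  rw [weightSum_eq_sum_mul a q (Finset.Ico 1 N) (paths m n s l \ paths m n (s + 1) l)
    (fun i => arrivals m n (n * (i - ε) + α) (m * i - β))
    (fun i => tails m n (n * (N - i : ℕ) - α) (m * ((N - i : ℕ) - ε) + β))
    (fun i => n * (i - ε) + α) (fun i => m * i - β)
    (fun i => n * (N - i : ℕ) - α) (fun i => m * ((N - i : ℕ) - ε) + β)
    (fun i _ u hu => hu.1) (fun i _ v hv => hv.1)]
  · refine Finset.sum_congr rfl fun i hi => ?_
    rw [Finset.mem_Ico] at hi
    rw [hs]
    congr 4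
    push_cast [hi.2.le]
    ring
  · intro i _ j _ _ hij
    have : (m : ℤ) * i = m * j := by linarith
    exact_mod_cast mul_left_cancel₀ hm'.ne' this
  · intro i hi u hu v hv
    rw [Finset.mem_Ico] at hi
    have hi1 : (1 : ℤ) ≤ i := by exact_mod_cast hi.1
    have hi2 : (1 : ℤ) ≤ (N - i : ℕ) := by exact_mod_cast (by omega : 1 ≤ N - i)
    have hsplit0 : yEnd u ≠ 0 := by rw [hu.1.2]; nlinarith
    have hsplit1 : xEnd v ≠ 0 := by rw [hv.1.1]; nlinarith
    have hcast : ((N - i : ℕ) : ℤ) = l + ε - i := by push_cast [hi.2.le]; linarith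
    have hend : xEnd (u ++ v) = n * l ∧ yEnd (u ++ v) = m * l := by
      rw [xEnd_append, yEnd_append, hu.1.1, hu.1.2, hv.1.1, hv.1.2, hcast]
      constructor <;> ring
    have hl : 0 < l := by
      have h1 := hend.1
      rw [xEnd_append] at h1
      have := xEnd_nonneg u
      have := xEnd_nonneg v
      rcases Nat.eq_zero_or_pos l with rfl | h
      · simp at h1; omega
      · exact h
    refine ⟨⟨?_, hend, ?_⟩, fun h => ?_⟩
    · exact hsmn.le.trans (Nat.le_mul_of_pos_right _ hl)
    · intro c d hcd hd hc
      rcases List.append_eq_append_iff.1 hcd with ⟨w, rfl, rfl⟩ | ⟨w, rfl, rfl⟩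
      · rw [height_append, hheight i u hu]
        have := hv.2 w d rfl hd
        linarith
      · have h1 := hheight i _ hu
        by_cases hw : w = []
        · subst hw
          rw [List.append_nil] at h1
          exact h1.ge
        · have := hu.2 c w rfl hw hc
          rw [height_append] at h1
          linarith
    · have := h.2.2 u v rfl hsplit1 hsplit0
      rw [hheight i u hu] at this
      push_cast at this
      omega
  · rintro p ⟨hp, hp'⟩
    have hl : 0 < l := by
      have := hp.1
      rcases Nat.eq_zero_or_pos l with rfl | h
      · simp at this; omega
      · exact h
    have hex : ∃ u v, p = u ++ v ∧ (xEnd v ≠ 0 ∧ yEnd u ≠ 0 ∧ height m n u = s) := by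
      by_contra hcon
      refine hp' ⟨(Nat.succ_le_of_lt hsmn).trans (Nat.le_mul_of_pos_right _ hl), hp.2.1,
        fun u v h hv hu => ?_⟩
      have h1 := hp.2.2 u v h hv hu
      have h2 : height m n u ≠ s := fun h2 => hcon ⟨u, v, h, hv, hu, h2⟩
      push_cast
      omega
    obtain ⟨u, v, rfl, ⟨hv, hu, hus⟩, hfirst⟩ := exists_first_split hex
    have hus' : (m : ℤ) * (xEnd u - α + n * ε) = n * (yEnd u + β) := by
      rw [height, hs] at hus
      linarith
    obtain ⟨k, hk1, hk2⟩ := eq_mul_of_coprime hn hmn hus'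
    have hu1 : 0 < yEnd u := lt_of_le_of_ne (yEnd_nonneg u) hu.symm
    have hv1 : 0 < xEnd v := lt_of_le_of_ne (xEnd_nonneg v) hv.symm
    have hx := hp.2.1.1
    have hy := hp.2.1.2
    rw [xEnd_append] at hx
    rw [yEnd_append] at hy
    have hk0 : 0 < k := pos_of_mul_pos_right (by rw [← hk2]; positivity) hm'.le
    have hkN : k < N := by
      have : (n : ℤ) * k < n * N := by rw [hN]; nlinarith [Int.natCast_nonneg α]
      exact lt_of_mul_lt_mul_left this hn'.le
    lift k to ℕ using hk0.le
    have hk0' : 0 < k := by exact_mod_cast hk0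
    have hkN' : k < N := by exact_mod_cast hkN
    have hcast : ((N - k : ℕ) : ℤ) = l + ε - k := by push_cast [hkN'.le]; linarith
    refine ⟨k, Finset.mem_Ico.2 ⟨hk0', hkN'⟩, u, ⟨⟨by linarith, by linarith⟩, ?_⟩, v,
      ⟨⟨by rw [hcast]; linarith, by rw [hcast]; linarith⟩, ?_⟩, rfl⟩
    · rintro c w rfl hw hc
      have hxw : xEnd (w ++ v) ≠ 0 := by
        have := xEnd_nonneg w
        rw [xEnd_append]
        omega
      have h1 := hp.2.2 c (w ++ v) (by simp) hxw hc
      have h2 : height m n c ≠ s := fun h => hfirst c w rfl hw ⟨hxw, hc, h⟩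
      rw [height_append] at hus
      omega
    · rintro c d rfl hd
      have hyc : yEnd (u ++ c) ≠ 0 := by
        have := yEnd_nonneg c
        rw [yEnd_append]
        omega
      have h1 := hp.2.2 (u ++ c) d (by simp) hd hyc
      rw [height_append, hus] at h1
      linarith
  · intro i hi j hj u w v hu hwv huw hv
    by_contra hw
    rw [Finset.mem_Ico] at hi
    have hi1 : (1 : ℤ) ≤ i := by exact_mod_cast hi.1
    have h1 := huw.2 u w rfl hw (by rw [hu.1.2]; nlinarith)
    have h2 := hheight j _ huw
    rw [height_append, hheight i u hu] at h2
    omega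

/-- The coefficientwise form of the equation for `y^{[s]}`, `0 < s < m n`. -/
theorem weightSum_paths_eq_add_sum {m n α β s l N : ℕ} {ε : ℤ} (hm : 0 < m) (hn : 0 < n)
    (hmn : Nat.Coprime m n) (hα : α < n) (hβ : β < m) (hs0 : 0 < s) (hsmn : s < m * n)
    (hs : (s : ℤ) = (α : ℤ) * m + β * n - m * n * ε) (hN : (N : ℤ) = l + ε) :
    weightSum a q (paths m n s l) = weightSum a q (paths m n (s + 1) l) +
      ((q ^ ((m : ℤ) * n * ε ^ 2 - 2 * (α : ℤ) * β) : Rˣ) : R) *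
        ∑ i ∈ Finset.Ico 1 N,
          ((q ^ (2 * ((s : ℤ) - (β : ℤ) * n)) : Rˣ) : R) ^ i *
            weightSum a q (paths m n (β * n + 1) i) *
          ∑ k ∈ Finset.range (N - i),
            ((q ^ (2 * (s : ℤ)) : Rˣ) : R) ^ k * weightSum a q (paths m n 0 k) *
            (((q ^ (2 * ((s : ℤ) - (α : ℤ) * m)) : Rˣ) : R) ^ (N - i - k) *
              weightSum a q (paths m n (α * m + 1) (N - i - k))) := by
  have hs' : 0 < (α : ℤ) * m + β * n - m * n * ε := by rw [← hs]; exact_mod_cast hs0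
  rw [weightSum_paths_eq_add a q hn hmn hα hβ hs0 hsmn hs hN]
  congr 1
  rw [Finset.mul_sum]
  refine Finset.sum_congr rfl fun i hi => ?_
  rw [Finset.mem_Ico] at hi
  rw [weightSum_arrivals_eq_paths a q hm hn hβ (by omega) hs',
    weightSum_tails_eq_sum a q hm hn hmn hα (by omega) hs', Finset.mul_sum, Finset.mul_sum,
    Finset.mul_sum, Finset.mul_sum]
  refine Finset.sum_congr rfl fun k hk => ?_
  rw [Finset.mem_range] at hk
  have hexp : ((q ^ ((s : ℤ) * (N - ε)) : Rˣ) : R) *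
      ((q ^ ((α - n * ε) * (m * i - β) - n * i * β) : Rˣ) : R) *
      ((q ^ (((α : ℤ) * m + β * n - m * n * ε) * k +
          ((β - m * ε) * (n * (N - i - k : ℕ) - α) - m * (N - i - k : ℕ) * α)) : Rˣ) : R) =
      ((q ^ ((m : ℤ) * n * ε ^ 2 - 2 * (α : ℤ) * β) : Rˣ) : R) *
      ((q ^ (2 * ((s : ℤ) - (β : ℤ) * n)) : Rˣ) : R) ^ i *
      ((q ^ (2 * (s : ℤ)) : Rˣ) : R) ^ k *
      ((q ^ (2 * ((s : ℤ) - (α : ℤ) * m)) : Rˣ) : R) ^ (N - i - k) := by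
    simp only [← Units.val_pow_eq_pow_val, ← Units.val_mul, ← zpow_natCast, ← zpow_mul, ← zpow_add]
    congr 2
    have h1 : ((N - i - k : ℕ) : ℤ) = N - i - k := by omega
    rw [h1, hs]
    ring
  linear_combination
    (weightSum a q (paths m n (β * n + 1) i) * (weightSum a q (paths m n 0 k) *
      weightSum a q (paths m n (α * m + 1) (N - i - k)))) * hexp

/-- The only path counted by `y^{[m n]}` that does not start with `n` horizontal and end with `m`
vertical steps. -/
def hookPath (m n : ℕ) : List Step :=
  List.replicate (n - 1) Step.right ++ (Step.diag :: List.replicate (m - 1) Step.up)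

theorem weight_hookPath {m n : ℕ} (hm : 0 < m) (hn : 0 < n) :
    weight a q (hookPath m n) = a ^ 2 * ((q ^ ((m : ℤ) * n - 1) : Rˣ) : R) := by
  have hm' : ((m - 1 : ℕ) : ℤ) = m - 1 := by omega
  have hn' : ((n - 1 : ℕ) : ℤ) = n - 1 := by omega
  have h : twiceArea (hookPath m n) = m * n - 1 := by
    rw [hookPath, ← List.singleton_append, twiceArea_append, twiceArea_append,
      twiceArea_replicate, twiceArea_replicate]
    simp [hm', hn']
    ring
  rw [weight, h]
  simp [hookPath, List.count_replicate]

theorem hookPath_mem_paths {m n : ℕ} (hm : 0 < m) (hn : 0 < n) :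
    hookPath m n ∈ paths m n (m * n) 1 := by
  have hm' : ((m - 1 : ℕ) : ℤ) = m - 1 := by omega
  have hn' : ((n - 1 : ℕ) : ℤ) = n - 1 := by omega
  refine ⟨by simp, ⟨by simp [hookPath, hn'], by simp [hookPath, hm']⟩, ?_⟩
  intro u v h hv hu
  exfalso
  rcases List.append_eq_append_iff.1 h with ⟨w, rfl, hw⟩ | ⟨w, hw, rfl⟩
  · cases w with
    | nil => simp at hu
    | cons t w =>
      simp only [List.cons_append, List.cons.injEq] at hw
      have h1 := congrArg xEnd hw.2
      simp at h1
      have := xEnd_nonneg w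
      have := xEnd_nonneg v
      omega
  · have h1 := congrArg yEnd hw
    simp at h1
    have := yEnd_nonneg w
    have := yEnd_nonneg u
    omega

/-- A path counted by `y^{[m n]}` starts with `n` horizontal steps, unless it is `hookPath m n`. -/
theorem exists_eq_replicate_right_append {m n l : ℕ} (hm : 0 < m) (hn : 0 < n) (hl : 0 < l)
    {p : List Step} (hp : p ∈ paths m n (m * n) l) (hne : ¬ (l = 1 ∧ p = hookPath m n)) :
    ∃ v, p = List.replicate n Step.right ++ v := by
  have hm' : (0 : ℤ) < m := by exact_mod_cast hm
  have hn' : (0 : ℤ) < n := by exact_mod_cast hn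
  have hl' : (1 : ℤ) ≤ l := by exact_mod_cast hl
  have hnl : (n : ℤ) ≤ n * l := le_mul_of_one_le_right hn'.le hl'
  have hml : (m : ℤ) ≤ m * l := le_mul_of_one_le_right hm'.le hl'
  have strip : ∀ j ≤ n, ∃ v, p = List.replicate j Step.right ++ v := by
    intro j
    induction j with
    | zero => exact fun _ => ⟨p, by simp⟩
    | succ j ih =>
      intro hj
      obtain ⟨v, rfl⟩ := ih (by omega)
      have hj' : (j : ℤ) + 1 ≤ n := by exact_mod_cast hj
      have hmj : (m : ℤ) * (j + 1) ≤ m * n := mul_le_mul_of_nonneg_left hj' hm'.le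
      have hpx := hp.2.1.1
      have hpy := hp.2.1.2
      cases v with
      | nil =>
        simp at hpy
        omega
      | cons t v =>
        have key := hp.2.2 (List.replicate j Step.right ++ [t]) v (by simp)
        cases t with
        | right => exact ⟨v, by simp [List.replicate_succ']⟩
        | up =>
          exfalso
          simp at hpx key
          have := key (by omega)
          simp [height] at this
          nlinarith
        | diag =>
          exfalso
          simp at hpx hpy key
          by_cases hv : xEnd v = 0
          · have hjn : (j : ℤ) + 1 = n * l := by omega
            have hl1 : l = 1 := by
              have : (n : ℤ) * l ≤ n * 1 := by linarith
              have := le_of_mul_le_mul_left this hn'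
              omega
            subst hl1
            refine hne ⟨rfl, ?_⟩
            have hv' := eq_replicate_up_of_xEnd_eq_zero hv
            have h1 : (yEnd v).toNat = m - 1 := by simp at hpy; omega
            have h2 : j = n - 1 := by simp at hjn; omega
            rw [h1] at hv'
            rw [hv', h2, hookPath]
          · have := key hv
            simp [height] at this
            nlinarith
  exact strip n le_rfl

/-- The coefficientwise form of the equation for `y^{[m n]}`. -/
theorem weightSum_paths_mul {m n : ℕ} (hm : 0 < m) (hn : 0 < n) (l : ℕ) :
    weightSum a q (paths m n (m * n) (l + 1)) =
      (if l = 0 then a ^ 2 * ((q ^ ((m : ℤ) * n - 1) : Rˣ) : R) else 0) +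
        (q : R) ^ (m * n) * (((q ^ (2 * ((m : ℤ) * n)) : Rˣ) : R) ^ l *
          weightSum a q (paths m n 0 l)) := by
  have hm' : (0 : ℤ) < m := by exact_mod_cast hm
  have hn' : (0 : ℤ) < n := by exact_mod_cast hn
  let H : Set (List Step) := {p | l = 0 ∧ p = hookPath m n}
  let S' : Set (List Step) := {p | ∃ c ∈ paths m n 0 l, p = c ++ List.replicate m Step.up}
  have hH : H ⊆ paths m n (m * n) (l + 1) := by
    rintro p ⟨rfl, rfl⟩
    exact hookPath_mem_paths hm hn
  have hWH : weightSum a q H = if l = 0 then a ^ 2 * ((q ^ ((m : ℤ) * n - 1) : Rˣ) : R) else 0 := by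
    split_ifs with h
    · rw [← weight_hookPath a q hm hn, ← weightSum_singleton]
      congr 1
      ext p
      simp [H, h]
    · rw [← weightSum_empty a q]
      congr 1
      ext p
      simp [H, h]
  have hdiff : weightSum a q (paths m n (m * n) (l + 1)) = weightSum a q H +
      weightSum a q (paths m n (m * n) (l + 1) \ H) := by
    rw [weightSum, weightSum, weightSum, finsum_mem_add_sdiff hH (finite_paths _ _ _ _)]
  have hS' : weightSum a q S' = ((q ^ ((n : ℤ) * l * m) : Rˣ) : R) *
      weightSum a q (paths m n 0 l) := by
    rw [weightSum_eq_mul a q S' (paths m n 0 l) {List.replicate m Step.up} (n * l) (m * l) 0 m,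
      weightSum_replicate_up]
    · simp
    · exact fun u hu => hu.2.1
    · simp
    · rintro u hu v rfl
      exact ⟨u, hu, rfl⟩
    · rintro p ⟨c, hc, rfl⟩
      exact ⟨c, hc, _, rfl, rfl⟩
  have hD : weightSum a q (paths m n (m * n) (l + 1) \ H) =
      ((q ^ ((n : ℤ) * (m * l + m)) : Rˣ) : R) * weightSum a q S' := by
    rw [weightSum_eq_mul a q _ {List.replicate n Step.right} S' n 0 (n * l) (m * l + m),
      weightSum_replicate_right]
    · simp
    · simp
    · rintro v ⟨c, hc, rfl⟩
      simp [hc.2.1.1, hc.2.1.2]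
    · rintro u rfl v ⟨c, hc, rfl⟩
      refine ⟨⟨Nat.le_mul_of_pos_right _ (by omega), ?_, ?_⟩, ?_⟩
      · simp [hc.2.1.1, hc.2.1.2]
        constructor <;> ring
      · intro d e hde he hd
        rcases List.append_eq_append_iff.1 hde with ⟨w, rfl, hw⟩ | ⟨w, hw, rfl⟩
        · rcases List.append_eq_append_iff.1 hw with ⟨z, rfl, hz⟩ | ⟨z, rfl, rfl⟩
          · exfalso
            have h1 := congrArg xEnd hz
            simp at h1
            have := xEnd_nonneg z
            have := xEnd_nonneg e
            omega
          · have h1 := height_nonneg_of_mem_paths hc rfl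
            rw [height_append]
            have h2 : height m n (List.replicate n Step.right) = m * n := by simp [height]
            push_cast
            linarith
        · exfalso
          have h1 := congrArg yEnd hw
          simp at h1
          have := yEnd_nonneg w
          have := yEnd_nonneg d
          omega
      · rintro ⟨-, h⟩
        have h0 : n - 1 < n := by omega
        -- The step with index `n - 1` is horizontal on one side and diagonal on the other.
        have h1 := congrArg (fun p : List Step => p[n - 1]?) h
        simp [hookPath, List.getElem?_append, h0] at h1
    · rintro p ⟨hp, hpH⟩
      obtain ⟨v, rfl⟩ := exists_eq_replicate_right_append hm hn (Nat.succ_pos l) hp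
        fun h => hpH ⟨by omega, h.2⟩
      -- The reflected path is the subject of the same lemma, with `m` and `n` exchanged.
      have hpr : reflect (List.replicate n Step.right ++ v) ∈ paths n m (n * m) (l + 1) := by
        rw [← reflect_preimage_paths] at hp
        rw [mul_comm n m]
        exact hp
      have hne : ¬ (l + 1 = 1 ∧ reflect (List.replicate n Step.right ++ v) = hookPath n m) := by
        rintro ⟨hl, h⟩
        have h' := congrArg reflect h
        rw [reflect_reflect] at h'
        refine hpH ⟨by omega, h'.trans ?_⟩
        simp [hookPath, reflect, Step.swap]
      obtain ⟨w, hw⟩ := exists_eq_replicate_right_append hn hm (Nat.succ_pos l) hpr hne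
      have hsw : ∀ k, reflect (List.replicate k Step.right) = List.replicate k Step.up :=
        fun k => by simp [reflect, Step.swap]
      have hw' := congrArg reflect hw
      rw [reflect_reflect, reflect_append, hsw] at hw'
      have hx := hp.2.1.1
      have hy := hp.2.1.2
      rcases List.append_eq_append_iff.1 hw' with ⟨c, hc1, rfl⟩ | ⟨c, hc1, hc2⟩
      · refine ⟨_, rfl, _, ⟨c, ⟨by simp, ?_, ?_⟩, rfl⟩, rfl⟩
        · simp at hx hy
          constructor <;> linarith
        · rintro d e rfl he hd
          have hyd : yEnd (List.replicate n Step.right ++ d) ≠ 0 := by simpa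
          have := hp.2.2 (List.replicate n Step.right ++ d) (e ++ List.replicate m Step.up)
            (by simp) (by simpa) hyd
          rw [height_append] at this
          have h2 : height m n (List.replicate n Step.right) = m * n := by simp [height]
          push_cast at this ⊢
          linarith
      · -- The initial and the final run cannot overlap; here they abut, so the path is the one of
          -- size `1` without diagonal steps.
        have h1 := congrArg xEnd hc2
        have h2 := congrArg yEnd hc1
        have h3 := congrArg xEnd hc1
        simp at h1 h2 h3
        have hc : c = [] := by
          have := xEnd_nonneg c
          have := xEnd_nonneg v
          have := yEnd_nonneg c
          have := yEnd_nonneg (reflect w)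
          exact eq_nil_of_end_eq_zero (by omega) (by simp at *; omega)
        subst hc
        simp at hc2
        subst hc2
        simp at hx hy
        have hl : l = 0 := by
          have : (n : ℤ) * (l + 1) = n * 1 := by linarith
          have := mul_left_cancel₀ hn'.ne' this
          omega
        subst hl
        refine ⟨_, rfl, _, ⟨[], ?_, rfl⟩, by simp⟩
        rw [paths_zero_zero]
        rfl
  rw [hdiff, hWH, hD, hS', ← mul_assoc, ← mul_assoc]
  congr 2
  rw [← Units.val_pow_eq_pow_val, ← Units.val_pow_eq_pow_val, ← Units.val_mul, ← Units.val_mul]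
  simp only [← zpow_natCast, ← zpow_mul, ← zpow_add]
  congr 2
  push_cast
  ring

end Recursion

/-! ### The equations in terms of power series -/

section Series

open PowerSeries

variable {R : Type*} [CommRing R]

theorem coeff_qShift (q : Rˣ) (k : ℤ) (f : PowerSeries R) (l : ℕ) :
    coeff l (qShift q k f) = ((q ^ k : Rˣ) : R) ^ l * coeff l f := by
  rw [qShift, coeff_rescale]

theorem qShift_sub (q : Rˣ) (k : ℤ) (f g : PowerSeries R) :
    qShift q k (f - g) = qShift q k f - qShift q k g := map_sub _ _ _

theorem X_pow_dvd_qShift (q : Rˣ) (k : ℤ) {f : PowerSeries R} {d : ℕ}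
    (h : (X : PowerSeries R) ^ d ∣ f) : (X : PowerSeries R) ^ d ∣ qShift q k f := by
  rw [X_pow_dvd_iff] at h ⊢
  intro i hi
  rw [coeff_qShift, h i hi, mul_zero]

theorem X_dvd_qShift (q : Rˣ) (k : ℤ) {f : PowerSeries R} (h : (X : PowerSeries R) ∣ f) :
    (X : PowerSeries R) ∣ qShift q k f := by
  rw [← pow_one X] at h ⊢
  exact X_pow_dvd_qShift q k h

/-- Clearing the denominator `x^e` in an equation of Laurent series. -/
theorem coe_eq_add_single_mul_iff (e : ℕ) (c : R) (f g P : PowerSeries R) :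
    ((f : LaurentSeries R) = (g : LaurentSeries R) +
      HahnSeries.single (-(e : ℤ)) c * (P : LaurentSeries R)) ↔
        X ^ e * (f - g) = C c * P := by
  have hX : ((X ^ e : PowerSeries R) : LaurentSeries R) = HahnSeries.single (e : ℤ) 1 := by
    rw [coe_pow, coe_X, HahnSeries.single_pow]
    simp
  have h1 : (HahnSeries.single (e : ℤ) (1 : R)) * HahnSeries.single (-(e : ℤ)) c =
      HahnSeries.C c := by
    rw [HahnSeries.single_mul_single]
    simp [HahnSeries.C_apply]
  have h2 : (HahnSeries.single (-(e : ℤ)) (1 : R)) * HahnSeries.single (e : ℤ) (1 : R) = 1 := by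
    rw [HahnSeries.single_mul_single]
    simp
  have h3 : HahnSeries.single (-(e : ℤ)) (1 : R) * HahnSeries.C c =
      HahnSeries.single (-(e : ℤ)) c := by
    rw [HahnSeries.C_apply, HahnSeries.single_mul_single]
    simp
  rw [← (HahnSeries.ofPowerSeries_injective (Γ := ℤ) (R := R)).eq_iff, coe_mul, coe_mul, coe_C, hX,
    coe_sub]
  constructor
  · intro h
    rw [h, add_sub_cancel_left, ← mul_assoc, h1]
  · intro h
    have := congrArg (HahnSeries.single (-(e : ℤ)) (1 : R) * ·) h
    simp only [← mul_assoc, h2, h3, one_mul] at this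
    rw [← this, add_sub_cancel]

/-- The numbers `α_s`, `β_s`, `ε_s` satisfy `s = α m + β n - m n ε` with `ε ∈ {0, 1}`. -/
theorem Indices.exists_eps_eq {m n s α β : ℕ} {ε : ℤ} (hm : 0 < m) (hn : 0 < n)
    (h : Indices m n s α β ε) (hs : s < m * n) :
    ∃ e : ℕ, ε = e ∧ e ≤ 1 ∧ (s : ℤ) = (α : ℤ) * m + β * n - m * n * ε := by
  have hm' : (0 : ℤ) < m := by exact_mod_cast hm
  have hn' : (0 : ℤ) < n := by exact_mod_cast hn
  have hmn : (0 : ℤ) < m * n := by positivity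
  have heq : (m : ℤ) * n * ε = (α : ℤ) * m + β * n - s := by
    have h1 := h.eps_eq
    have hm0 : (m : ℚ) ≠ 0 := by exact_mod_cast hm.ne'
    have hn0 : (n : ℚ) ≠ 0 := by exact_mod_cast hn.ne'
    rw [eq_div_iff (mul_ne_zero hm0 hn0)] at h1
    have h2 : (m : ℚ) * n * ε = (α : ℚ) * m + β * n - s := by linarith
    exact_mod_cast h2
  have hα : (α : ℤ) * m < n * m :=
    mul_lt_mul_of_pos_right (by exact_mod_cast h.alpha_lt) hm'
  have hβ : (β : ℤ) * n < m * n :=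
    mul_lt_mul_of_pos_right (by exact_mod_cast h.beta_lt) hn'
  have hs' : (s : ℤ) < m * n := by exact_mod_cast hs
  have h0 : (-1 : ℤ) < ε := by
    have : (m : ℤ) * n * (-1) < m * n * ε := by
      rw [heq]
      have : (0 : ℤ) ≤ α * m := by positivity
      have : (0 : ℤ) ≤ β * n := by positivity
      linarith
    exact lt_of_mul_lt_mul_left this hmn.le
  have h2 : ε < 2 := by
    have : (m : ℤ) * n * ε < m * n * 2 := by
      rw [heq]
      have : (0 : ℤ) ≤ s := by positivity
      linarith
    exact lt_of_mul_lt_mul_left this hmn.le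
  lift ε to ℕ using (by omega)
  exact ⟨ε, rfl, by omega, by linarith⟩

theorem mul_add_one_le {m n β : ℕ} (hn : 0 < n) (h : β < m) : β * n + 1 ≤ m * n :=
  calc β * n + 1 ≤ (β + 1) * n := by linarith
    _ ≤ m * n := Nat.mul_le_mul_right _ h

theorem constantCoeff_genFun_of_pos {m n : ℕ} (hn : 0 < n) (a : R) (q : Rˣ) {s : ℕ}
    (hs : 0 < s) : constantCoeff (genFun m n a q s) = 0 := by
  rw [← coeff_zero_eq_constantCoeff_apply, coeff_genFun a q hn, paths_zero_right hs,
    weightSum_empty]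

theorem constantCoeff_genFun_zero {m n : ℕ} (hn : 0 < n) (a : R) (q : Rˣ) :
    constantCoeff (genFun m n a q 0) = 1 := by
  rw [← coeff_zero_eq_constantCoeff_apply, coeff_genFun a q hn, paths_zero_zero,
    weightSum_singleton]
  simp [weight]

/-- The equation for `y^{[s]}`, `0 < s < m n`, with the denominator `x^e` cleared, `e = ε_s`. -/
theorem genFun_mid {m n α β s e : ℕ} (hm : 0 < m) (hn : 0 < n) (hmn : Nat.Coprime m n)
    (a : R) (q : Rˣ) (hα : α < n) (hβ : β < m) (hs0 : 0 < s) (hsmn : s < m * n)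
    (he : e ≤ 1) (hs : (s : ℤ) = (α : ℤ) * m + β * n - m * n * (e : ℤ)) :
    X ^ e * (genFun m n a q s - genFun m n a q (s + 1)) =
      C ((q ^ ((m : ℤ) * n * (e : ℤ) ^ 2 - 2 * (α : ℤ) * β) : Rˣ) : R) *
        (qShift q (2 * (s : ℤ)) (genFun m n a q 0) *
          qShift q (2 * ((s : ℤ) - (β : ℤ) * n)) (genFun m n a q (β * n + 1)) *
          qShift q (2 * ((s : ℤ) - (α : ℤ) * m)) (genFun m n a q (α * m + 1))) := by
  have hz : ∀ t k, 0 < t → coeff 0 (qShift q k (genFun m n a q t)) = 0 := fun t k ht => by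
    rw [coeff_qShift, coeff_zero_eq_constantCoeff_apply, constantCoeff_genFun_of_pos hn a q ht,
      mul_zero]
  rw [mul_comm (qShift q (2 * (s : ℤ)) _), mul_assoc (qShift q (2 * ((s : ℤ) - (β : ℤ) * n)) _)]
  ext N
  rw [coeff_X_pow_mul', coeff_C_mul, coeff_mul, Finset.Nat.sum_antidiagonal_eq_sum_range_succ
    (fun i j => coeff i (qShift q (2 * ((s : ℤ) - (β : ℤ) * n)) (genFun m n a q (β * n + 1))) *
      coeff j (qShift q (2 * (s : ℤ)) (genFun m n a q 0) *
        qShift q (2 * ((s : ℤ) - (α : ℤ) * m)) (genFun m n a q (α * m + 1))))]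
  have hinner : ∀ L, coeff L (qShift q (2 * (s : ℤ)) (genFun m n a q 0) *
      qShift q (2 * ((s : ℤ) - (α : ℤ) * m)) (genFun m n a q (α * m + 1))) =
      ∑ k ∈ Finset.range L, ((q ^ (2 * (s : ℤ)) : Rˣ) : R) ^ k * weightSum a q (paths m n 0 k) *
        (((q ^ (2 * ((s : ℤ) - (α : ℤ) * m)) : Rˣ) : R) ^ (L - k) *
          weightSum a q (paths m n (α * m + 1) (L - k))) := by
    intro L
    rw [coeff_mul, Finset.Nat.sum_antidiagonal_eq_sum_range_succ
      (fun i j => coeff i (qShift q (2 * (s : ℤ)) (genFun m n a q 0)) *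
        coeff j (qShift q (2 * ((s : ℤ) - (α : ℤ) * m)) (genFun m n a q (α * m + 1)))),
      Finset.sum_range_succ, Nat.sub_self, hz _ _ (Nat.succ_pos _), mul_zero, add_zero]
    simp only [coeff_qShift, coeff_genFun a q hn]
  have houter : ∀ g : ℕ → R, g 0 = 0 → ∑ i ∈ Finset.range N.succ,
      coeff i (qShift q (2 * ((s : ℤ) - (β : ℤ) * n)) (genFun m n a q (β * n + 1))) * g (N - i) =
      ∑ i ∈ Finset.Ico 1 N,
        ((q ^ (2 * ((s : ℤ) - (β : ℤ) * n)) : Rˣ) : R) ^ i *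
          weightSum a q (paths m n (β * n + 1) i) * g (N - i) := by
    intro g hg
    rw [Finset.sum_range_succ, Nat.sub_self, hg, mul_zero, add_zero]
    rcases Nat.eq_zero_or_pos N with rfl | hN
    · simp
    · rw [Finset.range_eq_Ico, Finset.sum_eq_sum_Ico_succ_bot hN, hz _ _ (Nat.succ_pos _),
        zero_mul, zero_add]
      simp only [coeff_qShift, coeff_genFun a q hn]
  simp only [hinner]
  rw [houter (fun L => ∑ k ∈ Finset.range L,
      ((q ^ (2 * (s : ℤ)) : Rˣ) : R) ^ k * weightSum a q (paths m n 0 k) *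
        (((q ^ (2 * ((s : ℤ) - (α : ℤ) * m)) : Rˣ) : R) ^ (L - k) *
          weightSum a q (paths m n (α * m + 1) (L - k)))) (by simp)]
  split_ifs with heN
  · rw [map_sub, coeff_genFun a q hn, coeff_genFun a q hn,
      weightSum_paths_eq_add_sum a q (N := N) hm hn hmn hα hβ hs0 hsmn hs
        (by push_cast [heN]; ring), add_sub_cancel_left]
  · obtain rfl : N = 0 := by omega
    simp

/-- The generating functions solve the system. -/
theorem isSolution_genFun {m n : ℕ} (hm : 0 < m) (hn : 0 < n) (hmn : Nat.Coprime m n)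
    (a : R) (q : Rˣ) : IsSolution m n a q (genFun m n a q) where
  eq_zero := by
    rw [mul_sub, mul_one, sub_eq_iff_eq_add]
    ext l
    rw [map_add, coeff_mul, Finset.Nat.sum_antidiagonal_eq_sum_range_succ
      (fun i j => coeff i (genFun m n a q 0) * coeff j (genFun m n a q 1)),
      Finset.sum_range_succ, Nat.sub_self, coeff_zero_eq_constantCoeff_apply (φ := genFun m n a q 1),
      constantCoeff_genFun_of_pos hn a q one_pos, mul_zero, add_zero, coeff_one]
    split_ifs with hl
    · subst hl
      rw [coeff_zero_eq_constantCoeff_apply, constantCoeff_genFun_zero hn]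
      simp
    · rw [zero_add]
      simp only [coeff_genFun a q hn]
      exact weightSum_paths_zero a q hm hn hmn (Nat.pos_of_ne_zero hl)
  eq_mid := by
    intro s hs0 hsmn α β ε h
    obtain ⟨e, rfl, he, hs⟩ := h.exists_eps_eq hm hn hsmn
    rw [coe_eq_add_single_mul_iff]
    exact genFun_mid hm hn hmn a q h.alpha_lt h.beta_lt hs0 hsmn he hs
  eq_last := by
    ext l
    cases l with
    | zero =>
      rw [coeff_zero_eq_constantCoeff_apply,
        constantCoeff_genFun_of_pos hn a q (Nat.mul_pos hm hn)]
      simp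
    | succ l =>
      rw [coeff_genFun a q hn, weightSum_paths_mul a q hm hn, map_add, coeff_C_mul,
        mul_assoc (C _) X, coeff_C_mul, coeff_succ_X_mul, coeff_qShift, coeff_genFun a q hn,
        coeff_X]
      simp
  init_zero := constantCoeff_genFun_zero hn a q
  init_mid := fun _ hs _ => constantCoeff_genFun_of_pos hn a q hs
  init_last := constantCoeff_genFun_of_pos hn a q (Nat.mul_pos hm hn)

/-! ### Uniqueness -/

theorem IsSolution.X_dvd {m n : ℕ} {a : R} {q : Rˣ} {Y : ℕ → PowerSeries R}
    (h : IsSolution m n a q Y) {s : ℕ} (hs : 0 < s) (hsmn : s ≤ m * n) : X ∣ Y s := by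
  rw [X_dvd_iff]
  rcases hsmn.lt_or_eq with hlt | rfl
  · exact h.init_mid s hs hlt
  · exact h.init_last

/-- If two families agree up to order `x^l`, then a difference of triple products of the kind that
occurs in the system is of order `l + 1`; it is of order `l + 2` if the factors without constant
term agree to one order more (the cases `k = l` and `k = l + 1`). -/
theorem X_pow_dvd_mul_sub_mul {A A' B B' D D' : PowerSeries R} {l k : ℕ}
    (hB : X ∣ B) (hB' : X ∣ B') (hD : X ∣ D) (hk : k ≤ l + 1)
    (hAA : X ^ l ∣ A - A') (hBB : X ^ k ∣ B - B') (hDD : X ^ k ∣ D - D') :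
    X ^ (k + 1) ∣ A * B * D - A' * B' * D' := by
  have e : A * B * D - A' * B' * D' =
      (A - A') * (B * D) + A' * ((B - B') * D) + A' * ((D - D') * B') := by ring
  rw [e]
  refine dvd_add (dvd_add ?_ (Dvd.dvd.mul_left ?_ _)) (Dvd.dvd.mul_left ?_ _)
  · refine (pow_dvd_pow X (by omega : k + 1 ≤ l + 2)).trans ?_
    rw [pow_add, pow_two]
    exact mul_dvd_mul hAA (mul_dvd_mul hB hD)
  · rw [pow_succ]
    exact mul_dvd_mul hBB hD
  · rw [pow_succ]
    exact mul_dvd_mul hDD hB'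

theorem X_pow_dvd_of_X_pow_add_dvd {f : PowerSeries R} {d e : ℕ}
    (h : (X : PowerSeries R) ^ (d + e) ∣ X ^ e * f) : (X : PowerSeries R) ^ d ∣ f := by
  rw [X_pow_dvd_iff] at h ⊢
  intro i hi
  have := h (i + e) (by omega)
  rwa [add_comm i e, coeff_X_pow_mul', if_pos (by omega), Nat.add_sub_cancel_left] at this

/-- Two solutions agree to every order. The coefficients of `x^l` are determined by those of lower
order, in the order `s = m n, m n - 1, …, 1, 0`: if `ε_s = 1`, the equation for `y^{[s]}` involves
coefficients of `x^l` of other series, but only of those with a larger index. -/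
theorem IsSolution.X_pow_dvd_sub {m n : ℕ} (hm : 0 < m) (hn : 0 < n) (hmn : Nat.Coprime m n)
    {a : R} {q : Rˣ} {Y Z : ℕ → PowerSeries R} (hY : IsSolution m n a q Y)
    (hZ : IsSolution m n a q Z) (l : ℕ) : ∀ s ≤ m * n, X ^ l ∣ Y s - Z s := by
  have hmn0 : 0 < m * n := Nat.mul_pos hm hn
  induction l with
  | zero => simp
  | succ l ih =>
    have pos : ∀ j s, m * n - s = j → 0 < s → s ≤ m * n → X ^ (l + 1) ∣ Y s - Z s := by
      intro j
      induction j using Nat.strong_induction_on with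
      | _ j ihj =>
        intro s hj hs0 hsmn
        rcases hsmn.lt_or_eq with hlt | rfl
        · obtain ⟨α, β, ε, hI⟩ := exists_indices hm hn hmn s
          obtain ⟨e, rfl, he, hs⟩ := hI.exists_eps_eq hm hn hlt
          have h1 := (coe_eq_add_single_mul_iff e _ _ _ _).1 (hY.eq_mid s hs0 hlt α β e hI)
          have h2 := (coe_eq_add_single_mul_iff e _ _ _ _).1 (hZ.eq_mid s hs0 hlt α β e hI)
          have hβ := mul_add_one_le hn hI.beta_lt
          have hα : α * m + 1 ≤ m * n := by
            rw [mul_comm m n]; exact mul_add_one_le hm hI.alpha_lt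
          have order : ∀ t, 0 < t → t ≤ m * n → (e = 1 → s < t) →
              X ^ (l + e) ∣ Y t - Z t := by
            intro t ht0 htmn hst
            interval_cases e
            · exact ih t htmn
            · exact ihj (m * n - t) (by have := hst rfl; omega) t rfl ht0 htmn
          have hαβ : e = 1 → s < β * n + 1 ∧ s < α * m + 1 := by
            rintro rfl
            have h3 : (α : ℤ) * m + 1 ≤ m * n := by exact_mod_cast hα
            have h4 : (β : ℤ) * n + 1 ≤ m * n := by exact_mod_cast hβ
            push_cast at hs
            zify
            constructor <;> linarith
          have key := X_pow_dvd_mul_sub_mul (l := l) (k := l + e)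
            (A := qShift q (2 * (s : ℤ)) (Y 0)) (A' := qShift q (2 * (s : ℤ)) (Z 0))
            (B := qShift q (2 * ((s : ℤ) - (β : ℤ) * n)) (Y (β * n + 1)))
            (B' := qShift q (2 * ((s : ℤ) - (β : ℤ) * n)) (Z (β * n + 1)))
            (D := qShift q (2 * ((s : ℤ) - (α : ℤ) * m)) (Y (α * m + 1)))
            (D' := qShift q (2 * ((s : ℤ) - (α : ℤ) * m)) (Z (α * m + 1)))
            (X_dvd_qShift q _ (hY.X_dvd (Nat.succ_pos _) hβ))
            (X_dvd_qShift q _ (hZ.X_dvd (Nat.succ_pos _) hβ))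
            (X_dvd_qShift q _ (hY.X_dvd (Nat.succ_pos _) hα))
            (by omega)
            (by rw [← qShift_sub]; exact X_pow_dvd_qShift q _ (ih 0 (Nat.zero_le _)))
            (by
              rw [← qShift_sub]
              exact X_pow_dvd_qShift q _ (order _ (Nat.succ_pos _) hβ fun h => (hαβ h).1))
            (by
              rw [← qShift_sub]
              exact X_pow_dvd_qShift q _ (order _ (Nat.succ_pos _) hα fun h => (hαβ h).2))
          have hnext := ihj (m * n - (s + 1)) (by omega) (s + 1) rfl (Nat.succ_pos _) hlt
          have hdiff : X ^ (l + 1) ∣ (Y s - Y (s + 1)) - (Z s - Z (s + 1)) := by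
            apply X_pow_dvd_of_X_pow_add_dvd (e := e)
            rw [mul_sub, h1, h2, ← mul_sub, add_right_comm]
            exact Dvd.dvd.mul_left key _
          have := dvd_add hdiff hnext
          convert this using 1
          ring
        · have e : Y (m * n) - Z (m * n) = C ((q : R) ^ (m * n)) *
              (X * qShift q (2 * ((m : ℤ) * n)) (Y 0 - Z 0)) := by
            rw [hY.eq_last, hZ.eq_last, qShift_sub]
            ring
          rw [e, pow_succ']
          exact Dvd.dvd.mul_left (mul_dvd_mul_left _ (X_pow_dvd_qShift q _ (ih 0 (Nat.zero_le _)))) _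
    intro s hs
    rcases Nat.eq_zero_or_pos s with rfl | hs0
    · have e : Y 0 - Z 0 = Y 0 * Z 0 * (Y 1 - Z 1) := by
        linear_combination Z 0 * hY.eq_zero - Y 0 * hZ.eq_zero
      rw [e]
      exact Dvd.dvd.mul_left (pos _ 1 rfl one_pos hmn0) _
    · exact pos _ s rfl hs0 hs

theorem IsSolution.eq {m n : ℕ} (hm : 0 < m) (hn : 0 < n) (hmn : Nat.Coprime m n)
    {a : R} {q : Rˣ} {Y Z : ℕ → PowerSeries R} (hY : IsSolution m n a q Y)
    (hZ : IsSolution m n a q Z) {s : ℕ} (hs : s ≤ m * n) : Y s = Z s := by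
  ext i
  have h := X_pow_dvd_iff.1 (hY.X_pow_dvd_sub hm hn hmn hZ (i + 1) s hs) i (Nat.lt_succ_self i)
  rwa [map_sub, sub_eq_zero] at h

end Series

end SchroderPath

theorem theorem1p1 (m n : ℕ) (hm : 0 < m) (hn : 0 < n) (hmn : Nat.Coprime m n)
    {R : Type*} [CommRing R] (a : R) (q : Rˣ) :
    SchroderPath.IsSolution m n a q (SchroderPath.genFun m n a q) ∧
      ∀ Y : ℕ → PowerSeries R, SchroderPath.IsSolution m n a q Y →
        ∀ s ≤ m * n, Y s = SchroderPath.genFun m n a q s :=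
  ⟨SchroderPath.isSolution_genFun hm hn hmn a q, fun _ hY _ hs =>
    hY.eq hm hn hmn (SchroderPath.isSolution_genFun hm hn hmn a q) hs⟩
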